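/- Let $G$ be a Lie group with Lie algebra $\mathfrak g$ and exponential map $\exp$, acting smoothly and transitively on a smooth manifold $M$. Fix $o\in M$, let $K$ be its isotropy subgroup, with Lie algebra $\mathfrak k$, so that $M=G/K$, and let $\pi\colon G\to M$, $\pi(a)=a\cdot o$, be the natural projection, which is a submersion. Assume that $M$ is reductive, with decomposition $\mathfrak g=\mathfrak k\oplus\mathfrak m$, $[\mathfrak k,\mathfrak m]\subset\mathfrak m$. For $A\in\mathfrak g$ write $A_{\mathfrak m}=d\pi_e(A)\in T_oM$; this identifies $\mathfrak m$ with $T_oM$. Let $g$ be a $G$-invariant Riemannian metric on $M$ with Levi-Civita connection $\nabla$. For a smooth curve $\alpha\colon\mathbb R\to G$, $\gamma=\pi\circ\alpha$ and $W\in\mathfrak m$, put $$G_W(t)=g\big(\hat W_{\gamma(t)},\nabla_{\dot\gamma(t)}\dot\gamma(t)\big)_{\gamma(t)},\qquad \hat W_{\gamma(t)}=d\pi_{\alpha(t)}\big(W^L_{\alpha(t)}\big),$$ where $W^L$ is the left invariant vector field on $G$ with $W^L_e=W$ and $\nabla_{\dot\gamma}\dot\gamma$ is the covariant derivative of $\dot\gamma$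 along $\gamma$. **Proposition.** Let $X,Y,Z\in\mathfrak m$, let $\alpha(t)=\exp(tX)\exp(tY)\exp(tZ)$ and $\gamma(t)=\pi(\alpha(t))=\exp(tX)\exp(tY)\exp(tZ)\cdot o$, and let $T=T(t)=\operatorname{Ad}(\exp(-tZ)\exp(-tY))$. Then $\gamma$ is a smooth curve, and for every $W\in\mathfrak m$ and every $t\in\mathbb R$, $$G_W(t)=g\big((TX)_{\mathfrak m}+(TY)_{\mathfrak m}+Z_{\mathfrak m},\,[W,TX+TY+Z]_{\mathfrak m}\big)_o+g\big(W_{\mathfrak m},\,[TX,TY+Z]_{\mathfrak m}+[TY,Z]_{\mathfrak m}\big)_o .$$ -/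

import Mathlib

open scoped Manifold ContDiff

noncomputable section

namespace HomogeneousGeodesics

section LieGroup

variable {E : Type*} [NormedAddCommGroup E] [NormedSpace ℝ E]
  {G : Type*} [TopologicalSpace G] [ChartedSpace E G] [Group G]

open Classical in
/-- The exponential map `exp : 𝔤 → G` of a Lie group: `exp X = φ 1`, where `φ : ℝ → G` is the
integral curve, with `φ 0 = 1`, of the left invariant vector field determined by `X`.
(For a Lie group this curve exists and is unique, so the value `1` of the second branch is
never taken.) -/
def lieExp (X : GroupLieAlgebra 𝓘(ℝ, E) G) : G :=
  if h : ∃ φ : ℝ → G, φ 0 = 1 ∧ IsMIntegralCurve (I := 𝓘(ℝ, E)) φ (mulInvariantVectorField X)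
  then h.choose 1 else 1

/-- The adjoint representation: `Ad a` is the differential at the identity of the conjugation
`h ↦ a h a⁻¹`. -/
def Ad (a : G) : GroupLieAlgebra 𝓘(ℝ, E) G →L[ℝ] GroupLieAlgebra 𝓘(ℝ, E) G :=
  mfderiv 𝓘(ℝ, E) 𝓘(ℝ, E) (fun h : G => a * h * a⁻¹) 1

end LieGroup

section LeviCivita

variable {F : Type*} [NormedAddCommGroup F] [NormedSpace ℝ F] [FiniteDimensional ℝ F]
  {M : Type*} [TopologicalSpace M] [ChartedSpace F M] [IsManifold 𝓘(ℝ, F) ∞ M]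

/-- The coordinate vector field `∂/∂xⁱ` of the chart at `p`, at the point with coordinates `y`.
The coordinates are those of the chart in a fixed basis of the model space. -/
def coordVector (p : M) (i : Fin (Module.finrank ℝ F)) (y : F) :
    TangentSpace 𝓘(ℝ, F) ((extChartAt 𝓘(ℝ, F) p).symm y) :=
  mfderiv 𝓘(ℝ, F) 𝓘(ℝ, F) (extChartAt 𝓘(ℝ, F) p).symm y (Module.finBasis ℝ F i)

/-- The coefficients `g_{ij} = g(∂/∂xⁱ, ∂/∂xʲ)` of a Riemannian metric in the chart at `p`, as
functions of the coordinates. -/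
def metricCoeff
    (g : Bundle.ContMDiffRiemannianMetric 𝓘(ℝ, F) ∞ F (fun x : M => TangentSpace 𝓘(ℝ, F) x))
    (p : M) (i j : Fin (Module.finrank ℝ F)) (y : F) : ℝ :=
  g.inner ((extChartAt 𝓘(ℝ, F) p).symm y) (coordVector p i y) (coordVector p j y)

/-- The Christoffel symbols of the Levi-Civita connection of `g` in the chart at `p`:
`Γᵏᵢⱼ = ½ ∑ₗ gᵏˡ (∂ᵢ gⱼₗ + ∂ⱼ gᵢₗ - ∂ₗ gᵢⱼ)`. -/
def christoffel
    (g : Bundle.ContMDiffRiemannianMetric 𝓘(ℝ, F) ∞ F (fun x : M => TangentSpace 𝓘(ℝ, F) x))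
    (p : M) (k i j : Fin (Module.finrank ℝ F)) (y : F) : ℝ :=
  1 / 2 * ∑ l, (Matrix.of fun a b => metricCoeff g p a b y)⁻¹ k l *
    (fderiv ℝ (metricCoeff g p j l) y (Module.finBasis ℝ F i)
      + fderiv ℝ (metricCoeff g p i l) y (Module.finBasis ℝ F j)
      - fderiv ℝ (metricCoeff g p i j) y (Module.finBasis ℝ F l))

/-- The velocity vector field `γ̇` along a curve `γ`. -/
def velocity (γ : ℝ → M) (s : ℝ) : TangentSpace 𝓘(ℝ, F) (γ s) :=
  mfderiv 𝓘(ℝ, ℝ) 𝓘(ℝ, F) γ s (1 : ℝ)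

/-- The Levi-Civita covariant derivative `∇_{γ̇} V` at time `t` of a vector field `V` along the
curve `γ`, in the coordinates `xⁱ` of the chart at `γ t`:
`∑ₖ (V̇ᵏ + ∑ᵢⱼ Γᵏᵢⱼ ẋⁱ Vʲ) ∂/∂xᵏ`. -/
def covDerivAlong
    (g : Bundle.ContMDiffRiemannianMetric 𝓘(ℝ, F) ∞ F (fun x : M => TangentSpace 𝓘(ℝ, F) x))
    (γ : ℝ → M) (V : ∀ s, TangentSpace 𝓘(ℝ, F) (γ s)) (t : ℝ) :
    TangentSpace 𝓘(ℝ, F) (γ t) :=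
  let φ := extChartAt 𝓘(ℝ, F) (γ t)
  let x : Fin (Module.finrank ℝ F) → ℝ → ℝ := fun i s => (Module.finBasis ℝ F).coord i (φ (γ s))
  let v : Fin (Module.finrank ℝ F) → ℝ → ℝ := fun i s =>
    (Module.finBasis ℝ F).coord i (mfderiv 𝓘(ℝ, F) 𝓘(ℝ, F) φ (γ s) (V s))
  ∑ k, (deriv (v k) t
      + ∑ i, ∑ j, christoffel g (γ t) k i j (φ (γ t)) * deriv (x i) t * v j t) •
    (coordVector (γ t) k (φ (γ t)) : F)

end LeviCivita

section HomogeneousSpace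

variable {E : Type*} [NormedAddCommGroup E] [NormedSpace ℝ E]
  {G : Type*} [TopologicalSpace G] [ChartedSpace E G] [Group G]
  {F : Type*} [NormedAddCommGroup F] [NormedSpace ℝ F]
  {M : Type*} [TopologicalSpace M] [ChartedSpace F M] [MulAction G M]

/-- `𝔤 = 𝔨 ⊕ 𝔪` is a reductive decomposition for the homogeneous space `M = G/K`, where `K` is
the isotropy subgroup of `o` and `𝔨 = {A | exp(tA) ∈ K for all t}` is its Lie algebra. -/
structure IsReductiveDecomposition (o : M) (𝔨 𝔪 : Submodule ℝ (GroupLieAlgebra 𝓘(ℝ, E) G)) :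
    Prop where
  mem_isotropy : ∀ A : GroupLieAlgebra 𝓘(ℝ, E) G,
    A ∈ 𝔨 ↔ ∀ t : ℝ, lieExp (t • A) ∈ MulAction.stabilizer G o
  isCompl : IsCompl 𝔨 𝔪
  bracket_mem : ∀ A ∈ 𝔨, ∀ B ∈ 𝔪, ⁅A, B⁆ ∈ 𝔪

/-- The differential `dπ_e : 𝔤 → T_o M` at the identity of the projection `π : G → M = G/K`,
`π(a) = a · o`. Thus `projO o A` is the vector written `A_𝔪`; the restriction of this map to `𝔪`
is the identification `𝔪 ≅ T_o M`. -/
def projO (o : M) : GroupLieAlgebra 𝓘(ℝ, E) G →L[ℝ] TangentSpace 𝓘(ℝ, F) o :=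
  mfderiv 𝓘(ℝ, E) 𝓘(ℝ, F) (fun a : G => a • o) 1

/-- The vector `Ŵ = dπ_a(W^L_a) ∈ T_{π(a)} M`, where `W^L` is the left invariant vector field
determined by `W`. -/
def hatField (o : M) (W : GroupLieAlgebra 𝓘(ℝ, E) G) (a : G) : TangentSpace 𝓘(ℝ, F) (a • o) :=
  mfderiv 𝓘(ℝ, E) 𝓘(ℝ, F) (fun b : G => b • o) a (mulInvariantVectorField W a)

variable [FiniteDimensional ℝ F] [IsManifold 𝓘(ℝ, F) ∞ M]

variable (G) in
/-- `G`-invariance of a Riemannian metric: each translation `τ_a(x) = a · x` is an isometry. -/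
def IsInvariantMetric
    (g : Bundle.ContMDiffRiemannianMetric 𝓘(ℝ, F) ∞ F (fun x : M => TangentSpace 𝓘(ℝ, F) x)) :
    Prop :=
  ∀ (a : G) (x : M) (u v : TangentSpace 𝓘(ℝ, F) x),
    g.inner (a • x) (mfderiv 𝓘(ℝ, F) 𝓘(ℝ, F) (fun y : M => a • y) x u)
      (mfderiv 𝓘(ℝ, F) 𝓘(ℝ, F) (fun y : M => a • y) x v) = g.inner x u v

/-- The function `G_W(t) = g(Ŵ_{γ(t)}, ∇_{γ̇(t)} γ̇(t))_{γ(t)}` of the curve `γ = π ∘ α` in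
`M = G/K`, where `Ŵ_{γ(t)} = dπ_{α(t)}(W^L_{α(t)})`. -/
def functionG
    (g : Bundle.ContMDiffRiemannianMetric 𝓘(ℝ, F) ∞ F (fun x : M => TangentSpace 𝓘(ℝ, F) x))
    (o : M) (α : ℝ → G) (W : GroupLieAlgebra 𝓘(ℝ, E) G) (t : ℝ) : ℝ :=
  g.inner (α t • o) (hatField o W (α t))
    (covDerivAlong g (fun s => α s • o) (velocity fun s => α s • o) t)

end HomogeneousSpace

end HomogeneousGeodesics

end

open HomogeneousGeodesics

/-! Let `U(t)` be the left logarithmic derivative of a smooth curve `α` in `G`, so that `α̇ = U^L`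
along `α` and `γ̇` is the translate by `α` of `U_𝔪`. The heart of the proof is the formula `G_W =
g(U_𝔪, [W,U]_𝔪) + g(W_𝔪, (U')_𝔪)`, valid for every such `α` (`functionG_eq_of_hasLeftLogDerivAt`).

It comes from the first variation of energy. Let `c(s,t) = α(t) exp(sW) · o`, whose variation field
at `s = 0` is `Ŵ`. For the Levi-Civita connection, `g(∂ₛc, ∇ₜ∂ₜc) = ∂ₜ g(∂ₛc, ∂ₜc) - ½ ∂ₛ g(∂ₜc,
∂ₜc)`. By invariance the first product at `s = 0` is `g(W_𝔪, U_𝔪)`. The curve `t ↦ α(t) exp(sW)` has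
logarithmic derivative `Ad(exp(-sW)) U`, so the second product is the squared norm of its `𝔪`-part,
with `s`-derivative `-2 g(U_𝔪, [W,U]_𝔪)` at `0`. The first variation identity is checked in the
chart at `γ(t₀)` against the Christoffel symbols (`exists_hasDerivAt_energy_variation`,
`coordMetric_sum_christoffel`).

For the product of three exponentials, `U = TX + TY + Z` and `(TB)' = [TB, TY + Z]`, whence `U' =
[TX, TY + Z] + [TY, Z]`. This rests on the derivative of `Ad` along a curve
(`hasDerivAt_Ad_of_eq_one`), obtained from the coordinate formula for the Lie bracket. -/

/-! ### Velocities of curves in manifolds -/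

section Velocity

variable {E : Type*} [NormedAddCommGroup E] [NormedSpace ℝ E]
  {H : Type*} [TopologicalSpace H] {I : ModelWithCorners ℝ E H}
  {M : Type*} [TopologicalSpace M] [ChartedSpace H M]
  {E' : Type*} [NormedAddCommGroup E'] [NormedSpace ℝ E']
  {H' : Type*} [TopologicalSpace H'] {I' : ModelWithCorners ℝ E' H'}
  {M' : Type*} [TopologicalSpace M'] [ChartedSpace H' M']

/-- The chain rule for the image of a curve under a map. -/
lemma HasMFDerivAt.comp_velocity {γ : ℝ → M} {t : ℝ} {v : TangentSpace I (γ t)}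
    (h : HasMFDerivAt 𝓘(ℝ, ℝ) I γ t ((1 : ℝ →L[ℝ] ℝ).smulRight v))
    {f : M → M'} (hf : MDifferentiableAt I I' f (γ t)) :
    HasMFDerivAt 𝓘(ℝ, ℝ) I' (fun s => f (γ s)) t
      ((1 : ℝ →L[ℝ] ℝ).smulRight (mfderiv I I' f (γ t) v)) := by
  have aux : ∀ (A : E →L[ℝ] E') (w : E),
      A.comp ((1 : ℝ →L[ℝ] ℝ).smulRight w) = (1 : ℝ →L[ℝ] ℝ).smulRight (A w) := by
    intro A w
    ext
    simp
  exact (HasMFDerivAt.comp t hf.hasMFDerivAt h).congr_mfderiv (aux _ _)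

lemma HasMFDerivAt.mfderiv_one {γ : ℝ → M} {t : ℝ} {v : TangentSpace I (γ t)}
    (h : HasMFDerivAt 𝓘(ℝ, ℝ) I γ t ((1 : ℝ →L[ℝ] ℝ).smulRight v)) :
    mfderiv 𝓘(ℝ, ℝ) I γ t (1 : ℝ) = v := by
  rw [h.mfderiv]
  have aux : ∀ w : E, (1 : ℝ →L[ℝ] ℝ).smulRight w (1 : ℝ) = w := fun w => by simp
  exact aux v

lemma MDifferentiableAt.hasMFDerivAt_velocity {γ : ℝ → M} {t : ℝ}
    (h : MDifferentiableAt 𝓘(ℝ, ℝ) I γ t) :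
    HasMFDerivAt 𝓘(ℝ, ℝ) I γ t
      ((1 : ℝ →L[ℝ] ℝ).smulRight (mfderiv 𝓘(ℝ, ℝ) I γ t (1 : ℝ))) := by
  have aux : ∀ A : ℝ →L[ℝ] E, A = (1 : ℝ →L[ℝ] ℝ).smulRight (A 1) := fun A => by ext; simp
  exact h.hasMFDerivAt.congr_mfderiv (aux _)

/-- Passage from manifold derivatives to ordinary ones, used whenever a curve is read in a chart. -/
lemma hasMFDerivAt_smulRight_iff_hasDerivAt {f : ℝ → E} {t : ℝ} {v : E} :
    HasMFDerivAt 𝓘(ℝ, ℝ) 𝓘(ℝ, E) f t ((1 : ℝ →L[ℝ] ℝ).smulRight v) ↔ HasDerivAt f v t := by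
  have : (1 : ℝ →L[ℝ] ℝ).smulRight v = ContinuousLinearMap.toSpanSingleton ℝ v := by
    ext; simp
  rw [hasDerivAt_iff_hasFDerivAt, ← this]
  exact hasMFDerivAt_iff_hasFDerivAt

end Velocity

/-! ### Smoothness of integral curves -/

section IntegralCurveSmooth

open Set Filter Topology

/-- Solutions of an autonomous ordinary differential equation with smooth right-hand side are
smooth. -/
lemma contDiffOn_of_hasDerivAt_comp {V : Type*} [NormedAddCommGroup V] [NormedSpace ℝ V]
    {v : V → V} {Ω : Set V} (hv : ContDiffOn ℝ ∞ v Ω) {f : ℝ → V} {s : Set ℝ} (hs : IsOpen s)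
    (hmaps : MapsTo f s Ω) (hf : ∀ t ∈ s, HasDerivAt f (v (f t)) t) : ContDiffOn ℝ ∞ f s := by
  have key : ∀ n : ℕ, ContDiffOn ℝ n f s := by
    intro n
    -- Bootstrap: if `f` is `Cⁿ`, then so is `f' = v ∘ f`, hence `f` is `Cⁿ⁺¹`.
    induction n with
    | zero =>
      exact contDiffOn_zero.2 fun t ht => (hf t ht).continuousAt.continuousWithinAt
    | succ n ih =>
      push_cast
      rw [contDiffOn_succ_iff_deriv_of_isOpen hs]
      refine ⟨fun t ht => (hf t ht).differentiableAt.differentiableWithinAt, by simp, ?_⟩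
      refine ((hv.of_le (by exact_mod_cast le_top)).comp ih hmaps).congr fun t ht => ?_
      simp [(hf t ht).deriv]
  exact contDiffOn_infty.2 key

variable {E : Type*} [NormedAddCommGroup E] [NormedSpace ℝ E]
  {M : Type*} [TopologicalSpace M] [ChartedSpace E M] [IsManifold 𝓘(ℝ, E) ∞ M]

/-- The coordinate expression of a vector field in the chart at `p`. -/
noncomputable def coordField (p : M) (v : (x : M) → TangentSpace 𝓘(ℝ, E) x) (y : E) : E :=
  mfderiv 𝓘(ℝ, E) 𝓘(ℝ, E) (extChartAt 𝓘(ℝ, E) p) ((extChartAt 𝓘(ℝ, E) p).symm y)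
    (v ((extChartAt 𝓘(ℝ, E) p).symm y))

omit [IsManifold 𝓘(ℝ, E) ∞ M] in
lemma coordField_extChartAt (p : M) (v : (x : M) → TangentSpace 𝓘(ℝ, E) x) {x : M}
    (hx : x ∈ (extChartAt 𝓘(ℝ, E) p).source) :
    coordField p v (extChartAt 𝓘(ℝ, E) p x)
      = mfderiv 𝓘(ℝ, E) 𝓘(ℝ, E) (extChartAt 𝓘(ℝ, E) p) x (v x) := by
  -- Moving the base point changes the type of the tangent vectors. With values read in the model
  -- space and a variable point, the equality can be substituted. The same device recurs below.
  have aux : ∀ x' : M, x' = x →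
      (mfderiv 𝓘(ℝ, E) 𝓘(ℝ, E) (extChartAt 𝓘(ℝ, E) p) x' (v x') : E)
        = mfderiv 𝓘(ℝ, E) 𝓘(ℝ, E) (extChartAt 𝓘(ℝ, E) p) x (v x) := by
    rintro x' rfl
    rfl
  exact aux _ ((extChartAt 𝓘(ℝ, E) p).left_inv hx)

/-- The fibre coordinate of a section in the trivialization at `p` is the chart differential applied
to the vector, so smoothness of the section is smoothness of this map. -/
lemma contDiffOn_coordField (p : M) {v : (x : M) → TangentSpace 𝓘(ℝ, E) x}
    (hv : ContMDiff 𝓘(ℝ, E) 𝓘(ℝ, E).tangent ∞ fun x => (⟨x, v x⟩ : TangentBundle 𝓘(ℝ, E) M)) :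
    ContDiffOn ℝ ∞ (coordField p v) (extChartAt 𝓘(ℝ, E) p).target := by
  have : IsManifold 𝓘(ℝ, E) 1 M := .of_le (n := ∞) (by exact_mod_cast le_top)
  have h1 : ContMDiffOn 𝓘(ℝ, E) 𝓘(ℝ, E) ∞
      (fun x : M => (trivializationAt E (TangentSpace 𝓘(ℝ, E)) p ⟨x, v x⟩).2)
      (chartAt E p).source := by
    intro x hx
    exact ((Bundle.Trivialization.contMDiffAt_iff
      (IB := 𝓘(ℝ, E)) (e := trivializationAt E (TangentSpace 𝓘(ℝ, E)) p)
      (f := fun x => (⟨x, v x⟩ : TangentBundle 𝓘(ℝ, E) M)) (by simpa using hx)).1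
      (hv x)).2.contMDiffWithinAt
  have hmaps : ∀ y ∈ (extChartAt 𝓘(ℝ, E) p).target,
      (extChartAt 𝓘(ℝ, E) p).symm y ∈ (chartAt E p).source := fun y hy => by
    simpa only [extChartAt_source] using (extChartAt 𝓘(ℝ, E) p).map_target hy
  have h2 := h1.comp (contMDiffOn_extChartAt_symm (I := 𝓘(ℝ, E)) (n := ∞) p) hmaps
  rw [contMDiffOn_iff_contDiffOn] at h2
  refine h2.congr fun y hy => ?_
  rw [coordField, ← TangentBundle.continuousLinearMapAt_trivializationAt (hmaps y hy)]
  exact (Bundle.Trivialization.continuousLinearMapAt_apply_of_mem ℝ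
    (trivializationAt E (TangentSpace 𝓘(ℝ, E)) p) (by simpa using hmaps y hy) _)

/-- Integral curves of smooth vector fields are smooth. -/
lemma IsMIntegralCurve.contMDiff {v : (x : M) → TangentSpace 𝓘(ℝ, E) x}
    (hv : ContMDiff 𝓘(ℝ, E) 𝓘(ℝ, E).tangent ∞ fun x => (⟨x, v x⟩ : TangentBundle 𝓘(ℝ, E) M))
    {γ : ℝ → M} (hγ : IsMIntegralCurve γ v) : ContMDiff 𝓘(ℝ, ℝ) 𝓘(ℝ, E) ∞ γ := by
  have : IsManifold 𝓘(ℝ, E) 1 M := .of_le (n := ∞) (by exact_mod_cast le_top)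
  intro t₀
  rw [contMDiffAt_iff_target]
  refine ⟨(hγ t₀).continuousAt, ?_⟩
  set φ := extChartAt 𝓘(ℝ, E) (γ t₀) with hφ
  let s : Set ℝ := γ ⁻¹' φ.source
  have hs : IsOpen s := (isOpen_extChartAt_source (γ t₀)).preimage hγ.continuous
  have ht₀ : t₀ ∈ s := mem_extChartAt_source (I := 𝓘(ℝ, E)) (γ t₀)
  -- In the chart the curve solves the autonomous equation given by `coordField`.
  have key : ContDiffOn ℝ ∞ (φ ∘ γ) s := by
    refine contDiffOn_of_hasDerivAt_comp (contDiffOn_coordField (γ t₀) hv) hs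
      (fun t ht => φ.map_source ht) fun t ht => ?_
    have hd : MDifferentiableAt 𝓘(ℝ, E) 𝓘(ℝ, E) φ (γ t) :=
      mdifferentiableAt_extChartAt (by rw [← extChartAt_source 𝓘(ℝ, E)]; exact ht)
    rw [Function.comp_apply, coordField_extChartAt (γ t₀) v ht]
    exact hasMFDerivAt_smulRight_iff_hasDerivAt.1 ((hγ t).comp_velocity hd)
  exact (key.contDiffAt (hs.mem_nhds ht₀)).contMDiffAt

end IntegralCurveSmooth

/-! ### The exponential map and one-parameter subgroups -/

section Exponential

open Set Filter Topology

variable {E : Type*} [NormedAddCommGroup E] [NormedSpace ℝ E]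
  {G : Type*} [TopologicalSpace G] [ChartedSpace E G] [Group G] [LieGroup 𝓘(ℝ, E) ∞ G]

/-- The value at `g` is the differential of multiplication applied to `(0_g, v)`: a composite of the
zero section, a constant section and a tangent map, all smooth. -/
theorem contMDiff_infty_mulInvariantVectorField (v : GroupLieAlgebra 𝓘(ℝ, E) G) :
    ContMDiff 𝓘(ℝ, E) 𝓘(ℝ, E).tangent ∞
      (fun g : G => (⟨g, mulInvariantVectorField v g⟩ : TangentBundle 𝓘(ℝ, E) G)) := by
  let fg : G → TangentBundle 𝓘(ℝ, E) G := fun g ↦ Bundle.TotalSpace.mk' E g 0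
  have sfg : ContMDiff 𝓘(ℝ, E) 𝓘(ℝ, E).tangent ∞ fg := Bundle.contMDiff_zeroSection _ _
  let fv : G → TangentBundle 𝓘(ℝ, E) G := fun _ ↦ Bundle.TotalSpace.mk' E 1 v
  have sfv : ContMDiff 𝓘(ℝ, E) 𝓘(ℝ, E).tangent ∞ fv := contMDiff_const
  let F₁ : G → (TangentBundle 𝓘(ℝ, E) G × TangentBundle 𝓘(ℝ, E) G) := fun g ↦ (fg g, fv g)
  have S₁ : ContMDiff _ _ ∞ F₁ := sfg.prodMk sfv
  let F₂ : (TangentBundle 𝓘(ℝ, E) G × TangentBundle 𝓘(ℝ, E) G) →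
      TangentBundle (𝓘(ℝ, E).prod 𝓘(ℝ, E)) (G × G) :=
    (equivTangentBundleProd 𝓘(ℝ, E) G 𝓘(ℝ, E) G).symm
  have S₂ : ContMDiff _ _ ∞ F₂ := contMDiff_equivTangentBundleProd_symm
  let F₃ : TangentBundle (𝓘(ℝ, E).prod 𝓘(ℝ, E)) (G × G) → TangentBundle 𝓘(ℝ, E) G :=
    tangentMap (𝓘(ℝ, E).prod 𝓘(ℝ, E)) 𝓘(ℝ, E) (fun (p : G × G) ↦ p.1 * p.2)
  have S₃ : ContMDiff _ _ ∞ F₃ :=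
    ContMDiff.contMDiff_tangentMap (contMDiff_mul 𝓘(ℝ, E) ∞) (m := ∞) le_rfl
  let S := (S₃.comp S₂).comp S₁
  convert! S with g
  · simp [F₁, F₂, F₃, fg, fv]
  · simp only [Function.comp_apply, tangentMap, F₃, F₂, F₁, fg, fv]
    rw [mfderiv_prod_eq_add_apply ((contMDiff_mul 𝓘(ℝ, E) ∞).mdifferentiableAt (by simp))]
    change mulInvariantVectorField v g = mfderiv 𝓘(ℝ, E) 𝓘(ℝ, E) (fun z : G => z * 1) g 0
      + mfderiv 𝓘(ℝ, E) 𝓘(ℝ, E) (fun z : G => g * z) 1 v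
    rw [map_zero, zero_add]
    rfl

lemma mdifferentiableAt_mul_left_infty (a h : G) :
    MDifferentiableAt 𝓘(ℝ, E) 𝓘(ℝ, E) (fun x : G => a * x) h :=
  (contMDiff_mul_left (I := 𝓘(ℝ, E)) (n := ∞) (a := a)).mdifferentiableAt (by simp)

lemma mdifferentiableAt_mul_right_infty (a h : G) :
    MDifferentiableAt 𝓘(ℝ, E) 𝓘(ℝ, E) (fun x : G => x * a) h :=
  (contMDiff_mul_right (I := 𝓘(ℝ, E)) (n := ∞) (a := a)).mdifferentiableAt (by simp)

/-- Left invariant vector fields are preserved by left translations. -/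
lemma mfderiv_mul_left_mulInvariantVectorField (a h : G) (X : GroupLieAlgebra 𝓘(ℝ, E) G) :
    mfderiv 𝓘(ℝ, E) 𝓘(ℝ, E) (fun x : G => a * x) h (mulInvariantVectorField X h)
      = mulInvariantVectorField X (a * h) := by
  have hd := mdifferentiableAt_mul_left_infty (E := E) a (h * 1)
  have : (fun x : G => a * h * x) = (fun x => a * x) ∘ (fun x => h * x) := by
    ext x; simp [mul_assoc]
  unfold mulInvariantVectorField
  rw [this, mfderiv_comp (I' := 𝓘(ℝ, E)) _ hd (mdifferentiableAt_mul_left_infty h 1)]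
  have aux : ∀ p : G, p = h → ∀ w : E,
      (mfderiv 𝓘(ℝ, E) 𝓘(ℝ, E) (fun x : G => a * x) h : E →L[ℝ] E) w
        = (mfderiv 𝓘(ℝ, E) 𝓘(ℝ, E) (fun x : G => a * x) p : E →L[ℝ] E) w := by
    rintro p rfl w
    rfl
  exact aux _ (mul_one h) _

/-- The curve `β` in a Lie group has left logarithmic derivative `U` at time `t`. -/
def HasLeftLogDerivAt (β : ℝ → G) (U : GroupLieAlgebra 𝓘(ℝ, E) G) (t : ℝ) : Prop :=
  HasMFDerivAt 𝓘(ℝ, ℝ) 𝓘(ℝ, E) β t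
    ((1 : ℝ →L[ℝ] ℝ).smulRight (mulInvariantVectorField U (β t)))

lemma HasLeftLogDerivAt.const_mul {β : ℝ → G} {U : GroupLieAlgebra 𝓘(ℝ, E) G} {t : ℝ}
    (h : HasLeftLogDerivAt β U t) (a : G) : HasLeftLogDerivAt (fun s => a * β s) U t := by
  have h1 := h.comp_velocity (mdifferentiableAt_mul_left_infty a (β t))
  rwa [mfderiv_mul_left_mulInvariantVectorField a (β t) U] at h1

variable [T2Space G] [CompleteSpace E]

/-- Left translates of a local integral curve through `1` are integral curves through every point on
the same interval `(-ε, ε)`. A uniform existence time gives completeness. -/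
lemma exists_isMIntegralCurve_mulInvariantVectorField (X : GroupLieAlgebra 𝓘(ℝ, E) G) :
    ∃ φ : ℝ → G, φ 0 = 1 ∧ IsMIntegralCurve (I := 𝓘(ℝ, E)) φ (mulInvariantVectorField X) := by
  have hv := contMDiff_infty_mulInvariantVectorField X
  have hv1 := hv.of_le (m := 1) (by exact_mod_cast le_top)
  obtain ⟨γ, h0, hγ⟩ := exists_isMIntegralCurveAt_of_contMDiffAt_boundaryless
    (t₀ := 0) (hv1.contMDiffAt (x := 1))
  obtain ⟨ε, hε, hγ⟩ := isMIntegralCurveAt_iff'.1 hγ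
  refine exists_isMIntegralCurve_of_isMIntegralCurveOn hv1 hε (fun x => ?_) 1
  refine ⟨fun t => x * γ t, by simp [h0], ?_⟩
  rw [isMIntegralCurveOn_iff_isMIntegralCurveAt isOpen_Ioo]
  have hball : Ioo (-ε) ε = Metric.ball 0 ε := by simp [Real.ball_eq_Ioo]
  intro t ht
  rw [hball] at ht
  filter_upwards [Metric.isOpen_ball.mem_nhds ht] with s hs
  exact HasLeftLogDerivAt.const_mul
    ((hγ s hs).hasMFDerivAt (Metric.isOpen_ball.mem_nhds hs)) x

/-- Removes the choice in `lieExp`: `s ↦ φ (s * t)` is an integral curve for `t • X`, so by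
uniqueness it is the chosen one; then `s = 1`. -/
lemma lieExp_smul_eq {X : GroupLieAlgebra 𝓘(ℝ, E) G} {φ : ℝ → G} (h0 : φ 0 = 1)
    (hφ : IsMIntegralCurve (I := 𝓘(ℝ, E)) φ (mulInvariantVectorField X)) (t : ℝ) :
    lieExp (t • X) = φ t := by
  have hex := exists_isMIntegralCurve_mulInvariantVectorField (t • X)
  rw [lieExp, dif_pos hex]
  have h1 : IsMIntegralCurve (I := 𝓘(ℝ, E)) (φ ∘ (· * t)) (mulInvariantVectorField (t • X)) := by
    have := hφ.comp_mul t
    have e : t • mulInvariantVectorField (G := G) X = mulInvariantVectorField (t • X) := by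
      ext g
      exact (map_smul (mfderiv 𝓘(ℝ, E) 𝓘(ℝ, E) (fun a : G => g * a) 1) t X).symm
    rwa [e] at this
  have hv := (contMDiff_infty_mulInvariantVectorField (t • X)).of_le (m := 1)
    (by exact_mod_cast le_top)
  have := isMIntegralCurve_Ioo_eq_of_contMDiff_boundaryless (t₀ := 0) hv hex.choose_spec.2 h1
    (by simp [h0, hex.choose_spec.1])
  rw [this]
  simp

lemma isMIntegralCurve_lieExp (X : GroupLieAlgebra 𝓘(ℝ, E) G) :
    IsMIntegralCurve (I := 𝓘(ℝ, E)) (fun t : ℝ => lieExp (t • X)) (mulInvariantVectorField X) := by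
  obtain ⟨φ, h0, hφ⟩ := exists_isMIntegralCurve_mulInvariantVectorField X
  have : (fun t : ℝ => lieExp (t • X)) = φ := funext fun t => lieExp_smul_eq h0 hφ t
  rwa [this]

lemma hasLeftLogDerivAt_lieExp (X : GroupLieAlgebra 𝓘(ℝ, E) G) (t : ℝ) :
    HasLeftLogDerivAt (fun t : ℝ => lieExp (t • X)) X t :=
  isMIntegralCurve_lieExp X t

lemma contMDiff_lieExp_smul (X : GroupLieAlgebra 𝓘(ℝ, E) G) :
    ContMDiff 𝓘(ℝ, ℝ) 𝓘(ℝ, E) ∞ (fun t : ℝ => lieExp (t • X)) :=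
  (isMIntegralCurve_lieExp X).contMDiff (contMDiff_infty_mulInvariantVectorField X)

lemma lieExp_zero_smul (X : GroupLieAlgebra 𝓘(ℝ, E) G) : lieExp ((0 : ℝ) • X) = 1 := by
  obtain ⟨φ, h0, hφ⟩ := exists_isMIntegralCurve_mulInvariantVectorField X
  rw [lieExp_smul_eq h0 hφ, h0]

/-- As functions of `t`, both sides are integral curves of the same field with the same value at
`0`. -/
lemma lieExp_add_smul (X : GroupLieAlgebra 𝓘(ℝ, E) G) (s t : ℝ) :
    lieExp ((s + t) • X) = lieExp (s • X) * lieExp (t • X) := by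
  have hv := (contMDiff_infty_mulInvariantVectorField X).of_le (m := 1)
    (by exact_mod_cast le_top)
  have h1 := (isMIntegralCurve_lieExp X).comp_add s
  have h2 : IsMIntegralCurve (I := 𝓘(ℝ, E)) (fun t : ℝ => lieExp (s • X) * lieExp (t • X))
      (mulInvariantVectorField X) :=
    fun t => (hasLeftLogDerivAt_lieExp X t).const_mul (lieExp (s • X))
  have := isMIntegralCurve_Ioo_eq_of_contMDiff_boundaryless (t₀ := 0) hv h1 h2
    (by simpa using lieExp_zero_smul X)
  have := congrFun this t
  simpa [add_comm] using this

lemma lieExp_neg_smul (X : GroupLieAlgebra 𝓘(ℝ, E) G) (t : ℝ) :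
    lieExp (-(t • X)) = (lieExp (t • X))⁻¹ := by
  rw [eq_inv_iff_mul_eq_one, ← neg_smul, ← lieExp_add_smul, neg_add_cancel, lieExp_zero_smul]

end Exponential

/-! ### The Lie bracket in coordinates -/

section Bracket

open Set Filter Topology

variable {E : Type*} [NormedAddCommGroup E] [NormedSpace ℝ E]
  {M : Type*} [TopologicalSpace M] [ChartedSpace E M] [IsManifold 𝓘(ℝ, E) ∞ M]

/-- The Lie bracket of vector fields in the coordinates of the preferred chart. -/
lemma mlieBracket_eq_fderiv_coordField (p : M) (V W : (x : M) → TangentSpace 𝓘(ℝ, E) x) :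
    (VectorField.mlieBracket 𝓘(ℝ, E) V W p : E) =
      fderiv ℝ (coordField p W) (extChartAt 𝓘(ℝ, E) p p) (V p)
        - fderiv ℝ (coordField p V) (extChartAt 𝓘(ℝ, E) p p) (W p) := by
  have : IsManifold 𝓘(ℝ, E) 1 M := .of_le (n := ∞) (by exact_mod_cast le_top)
  set φ := extChartAt 𝓘(ℝ, E) p with hφ
  have hφp : φ p ∈ φ.target := mem_extChartAt_target p
  have htarget : φ.target ∈ 𝓝 (φ p) := extChartAt_target_mem_nhds p
  have hcoord : ∀ U : (x : M) → TangentSpace 𝓘(ℝ, E) x,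
      VectorField.mpullbackWithin 𝓘(ℝ, E) 𝓘(ℝ, E) φ.symm U (range 𝓘(ℝ, E))
        =ᶠ[𝓝 (φ p)] coordField p U := by
    intro U
    filter_upwards [htarget] with y hy
    rw [VectorField.mpullbackWithin_apply, coordField]
    have h1 := mfderivWithin_extChartAt_symm_comp_mfderiv_extChartAt (I := 𝓘(ℝ, E)) hy
    have h2 := mfderiv_extChartAt_comp_mfderivWithin_extChartAt_symm (I := 𝓘(ℝ, E)) hy
    rw [ContinuousLinearMap.inverse_eq h1 h2]
    rfl
  have hself : ∀ U : (x : M) → TangentSpace 𝓘(ℝ, E) x, coordField p U (φ p) = U p := by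
    intro U
    rw [coordField_extChartAt p U (mem_extChartAt_source p), mfderiv_extChartAt_self]
    rfl
  -- The bracket computed in the chart is carried back by the inverse of the chart differential at
  -- `p`, which is the identity for the preferred chart.
  have aux : ∀ A : E →L[ℝ] E, A = ContinuousLinearMap.id ℝ E → ∀ w : E, A.inverse w = w := by
    rintro _ rfl w
    simp
  have hset : φ.symm ⁻¹' univ ∩ range 𝓘(ℝ, E) = univ := by simp
  rw [← VectorField.mlieBracketWithin_univ, VectorField.mlieBracketWithin_apply, ← hφ, hset]
  refine (aux _ mfderiv_extChartAt_self _).trans ?_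
  have h := (hcoord V).lieBracket_vectorField_eq (𝕜 := ℝ) (hcoord W)
  refine (congrFun (VectorField.lieBracketWithin_univ (𝕜 := ℝ)) _).trans (h.trans ?_)
  rw [VectorField.lieBracket, hself, hself]

end Bracket

/-! ### Calculus of left logarithmic derivatives -/

section LogDeriv

open Set Filter Topology

variable {E : Type*} [NormedAddCommGroup E] [NormedSpace ℝ E]
  {G : Type*} [TopologicalSpace G] [ChartedSpace E G] [Group G] [LieGroup 𝓘(ℝ, E) ∞ G]

omit [LieGroup 𝓘(ℝ, E) ∞ G] in
lemma mulInvariantVectorField_neg (U : GroupLieAlgebra 𝓘(ℝ, E) G) (a : G) :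
    mulInvariantVectorField (-U) a = -mulInvariantVectorField U a :=
  map_neg (mfderiv 𝓘(ℝ, E) 𝓘(ℝ, E) (fun x : G => a * x) 1) U

omit [LieGroup 𝓘(ℝ, E) ∞ G] in
lemma mulInvariantVectorField_one (U : GroupLieAlgebra 𝓘(ℝ, E) G) :
    mulInvariantVectorField U (1 : G) = U := by
  have : (fun x : G => 1 * x) = id := by ext; simp
  rw [mulInvariantVectorField, this, mfderiv_id]
  rfl

lemma mdifferentiableAt_conj (a h : G) :
    MDifferentiableAt 𝓘(ℝ, E) 𝓘(ℝ, E) (fun x : G => a * x * a⁻¹) h :=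
  (mdifferentiableAt_mul_right_infty a⁻¹ (a * h)).comp h (mdifferentiableAt_mul_left_infty a h)

/-- Right translations of left invariant vector fields. -/
lemma mfderiv_mul_right_mulInvariantVectorField (a h : G) (X : GroupLieAlgebra 𝓘(ℝ, E) G) :
    mfderiv 𝓘(ℝ, E) 𝓘(ℝ, E) (fun x : G => x * a) h (mulInvariantVectorField X h)
      = mulInvariantVectorField (Ad a⁻¹ X) (h * a) := by
  have aux : ∀ p : G, p = h → ∀ w : E,
      (mfderiv 𝓘(ℝ, E) 𝓘(ℝ, E) (fun x : G => x * a) h : E →L[ℝ] E) w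
        = (mfderiv 𝓘(ℝ, E) 𝓘(ℝ, E) (fun x : G => x * a) p : E →L[ℝ] E) w := by
    rintro p rfl w
    rfl
  have aux' : ∀ p : G, p = 1 → ∀ w : E,
      (mfderiv 𝓘(ℝ, E) 𝓘(ℝ, E) (fun x : G => h * a * x) 1 : E →L[ℝ] E) w
        = (mfderiv 𝓘(ℝ, E) 𝓘(ℝ, E) (fun x : G => h * a * x) p : E →L[ℝ] E) w := by
    rintro p rfl w
    rfl
  -- `hxa = (ha)(a⁻¹xa)`, to be differentiated at `x = 1`.
  have h1 : (fun x : G => x * a) ∘ (fun x : G => h * x)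
      = (fun x : G => h * a * x) ∘ (fun x : G => a⁻¹ * x * a⁻¹⁻¹) := by
    ext x; simp [mul_assoc]
  have h2 := mfderiv_congr (I := 𝓘(ℝ, E)) (I' := 𝓘(ℝ, E)) (x := 1) h1
  rw [mfderiv_comp (I' := 𝓘(ℝ, E)) _ (mdifferentiableAt_mul_right_infty a _)
    (mdifferentiableAt_mul_left_infty h 1), mfderiv_comp (I' := 𝓘(ℝ, E)) _
    (mdifferentiableAt_mul_left_infty _ _) (mdifferentiableAt_conj a⁻¹ 1)] at h2
  have h3 := congrArg (fun A : E →L[ℝ] E => A X) h2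
  refine (aux _ (mul_one h) _).trans (h3.trans ?_)
  exact (aux' (a⁻¹ * 1 * a⁻¹⁻¹) (by simp) _).symm

/-- The product rule for left logarithmic derivatives. -/
lemma HasLeftLogDerivAt.mul {β δ : ℝ → G} {U V : GroupLieAlgebra 𝓘(ℝ, E) G} {t : ℝ}
    (hβ : HasLeftLogDerivAt β U t) (hδ : HasLeftLogDerivAt δ V t) :
    HasLeftLogDerivAt (fun s => β s * δ s) (Ad (δ t)⁻¹ U + V) t := by
  have h1 : HasMFDerivAt 𝓘(ℝ, ℝ) (𝓘(ℝ, E).prod 𝓘(ℝ, E)) (fun s => (β s, δ s)) t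
      ((1 : ℝ →L[ℝ] ℝ).smulRight ((mulInvariantVectorField U (β t) : E),
        (mulInvariantVectorField V (δ t) : E))) := by
    have aux : ∀ u v : E, ((1 : ℝ →L[ℝ] ℝ).smulRight u).prod ((1 : ℝ →L[ℝ] ℝ).smulRight v)
        = (1 : ℝ →L[ℝ] ℝ).smulRight (u, v) := by
      intro u v
      ext <;> simp
    exact (hβ.prodMk hδ).congr_mfderiv (aux _ _)
  have hm : MDifferentiableAt (𝓘(ℝ, E).prod 𝓘(ℝ, E)) 𝓘(ℝ, E) (fun p : G × G => p.1 * p.2)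
      (β t, δ t) := (contMDiff_mul 𝓘(ℝ, E) ∞).mdifferentiableAt (by simp)
  have h2 := HasMFDerivAt.comp_velocity h1 hm
  -- The differential of multiplication is the sum of a right translation of the first velocity and
  -- a left translation of the second.
  have h3 := mfderiv_mul_right_mulInvariantVectorField (δ t) (β t) U
  have h4 := mfderiv_mul_left_mulInvariantVectorField (β t) (δ t) V
  have h5 : mulInvariantVectorField (Ad (δ t)⁻¹ U + V) (β t * δ t)
      = mulInvariantVectorField (Ad (δ t)⁻¹ U) (β t * δ t)
        + mulInvariantVectorField V (β t * δ t) :=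
    map_add (mfderiv 𝓘(ℝ, E) 𝓘(ℝ, E) (fun x : G => (β t * δ t) * x) 1) _ _
  unfold HasLeftLogDerivAt
  rw [h5, ← h3, ← h4]
  exact h2.congr_mfderiv (congrArg (fun w : E => (1 : ℝ →L[ℝ] ℝ).smulRight w)
    (mfderiv_prod_eq_add_apply hm))

omit [LieGroup 𝓘(ℝ, E) ∞ G] in
lemma hasLeftLogDerivAt_const (a : G) (t : ℝ) :
    HasLeftLogDerivAt (fun _ => a) (0 : GroupLieAlgebra 𝓘(ℝ, E) G) t := by
  have h : mulInvariantVectorField (0 : GroupLieAlgebra 𝓘(ℝ, E) G) a = 0 :=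
    map_zero (mfderiv 𝓘(ℝ, E) 𝓘(ℝ, E) (fun x : G => a * x) 1)
  have aux : (0 : ℝ →L[ℝ] E) = (1 : ℝ →L[ℝ] ℝ).smulRight 0 := by ext; simp
  unfold HasLeftLogDerivAt
  rw [h]
  exact (hasMFDerivAt_const a t).congr_mfderiv aux

lemma HasLeftLogDerivAt.mul_const {β : ℝ → G} {U : GroupLieAlgebra 𝓘(ℝ, E) G} {t : ℝ}
    (hβ : HasLeftLogDerivAt β U t) (a : G) :
    HasLeftLogDerivAt (fun s => β s * a) (Ad a⁻¹ U) t := by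
  have := hβ.mul (hasLeftLogDerivAt_const a t)
  rwa [add_zero] at this

omit [LieGroup 𝓘(ℝ, E) ∞ G] in
/-- For a curve through the identity the left logarithmic derivative is the velocity. -/
lemma hasLeftLogDerivAt_iff_of_eq_one {β : ℝ → G} {U : E} {t : ℝ} (h : β t = 1) :
    HasLeftLogDerivAt β U t ↔ HasMFDerivAt 𝓘(ℝ, ℝ) 𝓘(ℝ, E) β t ((1 : ℝ →L[ℝ] ℝ).smulRight U) := by
  have aux : ∀ p : G, p = 1 →
      (mulInvariantVectorField (I := 𝓘(ℝ, E)) (G := G) (U : E) p : E) = U := by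
    rintro p rfl
    exact mulInvariantVectorField_one (U : E)
  unfold HasLeftLogDerivAt
  have h' := aux _ h
  constructor
  · intro H
    exact H.congr_mfderiv (congrArg (fun w : E => (1 : ℝ →L[ℝ] ℝ).smulRight w) h')
  · intro H
    exact H.congr_mfderiv (congrArg (fun w : E => (1 : ℝ →L[ℝ] ℝ).smulRight w) h'.symm)

/-- Left translation by `(β t)⁻¹` brings the curve to the identity, where the logarithmic derivative
is the velocity. The same translation gives existence. -/
lemma HasLeftLogDerivAt.unique {β : ℝ → G} {U V : GroupLieAlgebra 𝓘(ℝ, E) G} {t : ℝ}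
    (hU : HasLeftLogDerivAt β U t) (hV : HasLeftLogDerivAt β V t) : U = V := by
  have h1 := (hasLeftLogDerivAt_iff_of_eq_one (by simp)).1 (hU.const_mul (β t)⁻¹)
  have h2 := (hasLeftLogDerivAt_iff_of_eq_one (by simp)).1 (hV.const_mul (β t)⁻¹)
  exact h1.mfderiv_one.symm.trans h2.mfderiv_one

lemma exists_hasLeftLogDerivAt {β : ℝ → G} {t : ℝ}
    (hβ : MDifferentiableAt 𝓘(ℝ, ℝ) 𝓘(ℝ, E) β t) :
    ∃ U : GroupLieAlgebra 𝓘(ℝ, E) G, HasLeftLogDerivAt β U t := by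
  have h1 := hβ.hasMFDerivAt_velocity.comp_velocity
    (mdifferentiableAt_mul_left_infty (β t)⁻¹ (β t))
  have h2 := (hasLeftLogDerivAt_iff_of_eq_one (by simp)).2 h1
  have h3 := h2.const_mul (β t)
  simp only [mul_inv_cancel_left] at h3
  exact ⟨_, h3⟩

/-- The logarithmic derivative of the inverse of a curve. -/
lemma HasLeftLogDerivAt.inv {β : ℝ → G} {U : GroupLieAlgebra 𝓘(ℝ, E) G} {t : ℝ}
    (hβ : HasLeftLogDerivAt β U t) :
    HasLeftLogDerivAt (fun s => (β s)⁻¹) (-(Ad (β t) U)) t := by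
  have hd : MDifferentiableAt 𝓘(ℝ, ℝ) 𝓘(ℝ, E) (fun s => (β s)⁻¹) t :=
    ((contMDiff_inv 𝓘(ℝ, E) ∞).mdifferentiableAt (by simp)).comp t hβ.mdifferentiableAt
  obtain ⟨V, hV⟩ := exists_hasLeftLogDerivAt hd
  -- Once some derivative `V` exists, the product rule for `β β⁻¹ = 1` forces `Ad(β) U + V = 0`.
  have h1 := hβ.mul hV
  simp only [mul_inv_cancel, inv_inv] at h1
  have h2 := h1.unique (hasLeftLogDerivAt_const 1 t)
  rw [← eq_neg_of_add_eq_zero_right h2]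
  exact hV

end LogDeriv

/-! ### The derivative of the adjoint representation -/

section AdDeriv

open Set Filter Topology

variable {E : Type*} [NormedAddCommGroup E] [NormedSpace ℝ E]
  {G : Type*} [TopologicalSpace G] [ChartedSpace E G] [Group G] [LieGroup 𝓘(ℝ, E) ∞ G]

omit [LieGroup 𝓘(ℝ, E) ∞ G] in
lemma Ad_one_apply (X : GroupLieAlgebra 𝓘(ℝ, E) G) : Ad (1 : G) X = X := by
  have h : (fun h : G => 1 * h * 1⁻¹) = id := by ext; simp
  rw [Ad, h, mfderiv_id]
  rfl

lemma Ad_mul_apply (a b : G) (X : GroupLieAlgebra 𝓘(ℝ, E) G) : Ad (a * b) X = Ad a (Ad b X) := by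
  have aux : ∀ p : G, p = 1 → ∀ w : E,
      (mfderiv 𝓘(ℝ, E) 𝓘(ℝ, E) (fun x : G => a * x * a⁻¹) 1 : E →L[ℝ] E) w
        = (mfderiv 𝓘(ℝ, E) 𝓘(ℝ, E) (fun x : G => a * x * a⁻¹) p : E →L[ℝ] E) w := by
    rintro p rfl w
    rfl
  have h1 : (fun x : G => a * b * x * (a * b)⁻¹)
      = (fun x : G => a * x * a⁻¹) ∘ (fun x : G => b * x * b⁻¹) := by
    ext x; simp [mul_assoc]
  have h2 := mfderiv_congr (I := 𝓘(ℝ, E)) (I' := 𝓘(ℝ, E)) (x := 1) h1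
  rw [mfderiv_comp (I' := 𝓘(ℝ, E)) _ (mdifferentiableAt_conj a _)
    (mdifferentiableAt_conj b 1)] at h2
  have h3 := congrArg (fun A : E →L[ℝ] E => A X) h2
  refine Eq.trans h3 ?_
  exact (aux (b * 1 * b⁻¹) (by simp) _).symm

lemma HasLeftLogDerivAt.conj {β : ℝ → G} {U : GroupLieAlgebra 𝓘(ℝ, E) G} {t : ℝ}
    (hβ : HasLeftLogDerivAt β U t) (a : G) :
    HasLeftLogDerivAt (fun s => a * β s * a⁻¹) (Ad a U) t := by
  simpa only [inv_inv] using (hβ.const_mul a).mul_const a⁻¹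

lemma coordField_one_self (V : GroupLieAlgebra 𝓘(ℝ, E) G) :
    coordField 1 (mulInvariantVectorField V) (extChartAt 𝓘(ℝ, E) (1 : G) 1) = (V : E) := by
  rw [coordField_extChartAt _ _ (mem_extChartAt_source 1), mulInvariantVectorField_one,
    mfderiv_extChartAt_self]
  rfl

omit [LieGroup 𝓘(ℝ, E) ∞ G] in
lemma coordField_mulInvariantVectorField_neg (V : GroupLieAlgebra 𝓘(ℝ, E) G) :
    coordField (1 : G) (mulInvariantVectorField (-V))
      = -coordField (1 : G) (mulInvariantVectorField V) := by
  ext y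
  rw [Pi.neg_apply, coordField, coordField, mulInvariantVectorField_neg]
  exact map_neg (mfderiv 𝓘(ℝ, E) 𝓘(ℝ, E) (extChartAt 𝓘(ℝ, E) (1 : G))
    ((extChartAt 𝓘(ℝ, E) (1 : G)).symm y)) _

/-- The velocity in coordinates of a curve with known left logarithmic derivative. -/
lemma HasLeftLogDerivAt.hasDerivAt_extChartAt {β : ℝ → G} {U : GroupLieAlgebra 𝓘(ℝ, E) G} {t : ℝ}
    (hβ : HasLeftLogDerivAt β U t) (ht : β t ∈ (extChartAt 𝓘(ℝ, E) (1 : G)).source) :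
    HasDerivAt (fun s => extChartAt 𝓘(ℝ, E) (1 : G) (β s))
      (coordField 1 (mulInvariantVectorField U) (extChartAt 𝓘(ℝ, E) (1 : G) (β t))) t := by
  have : IsManifold 𝓘(ℝ, E) 1 G := .of_le (n := ∞) (by exact_mod_cast le_top)
  rw [coordField_extChartAt _ _ ht]
  exact hasMFDerivAt_smulRight_iff_hasDerivAt.1
    (HasMFDerivAt.comp_velocity hβ (mdifferentiableAt_extChartAt
      (by rw [← extChartAt_source 𝓘(ℝ, E)]; exact ht)))

variable [T2Space G] [CompleteSpace E]

/-- Let `q(s, r, s') = φ(β(s) exp(rB) β(s')⁻¹)`, with the two occurrences of `β` varied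
independently. The derivative of `Ad(β(s))B` is `D²q` on `(1,0,1)` and `(0,1,0)`. By bilinearity it
splits into the derivative of the field of `B` in the direction `U` and, by symmetry of `D²q`, minus
that of the field of `U` in the direction `B`. This difference is the bracket in coordinates. -/
lemma hasDerivAt_Ad_of_eq_one {β : ℝ → G} (hβ : ContMDiff 𝓘(ℝ, ℝ) 𝓘(ℝ, E) ∞ β) (h1 : β 0 = 1)
    {U : GroupLieAlgebra 𝓘(ℝ, E) G} (hU : HasLeftLogDerivAt β U 0)
    (B : GroupLieAlgebra 𝓘(ℝ, E) G) :
    HasDerivAt (fun s => (Ad (β s) B : E)) (⁅U, B⁆ : GroupLieAlgebra 𝓘(ℝ, E) G) 0 := by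
  set φ := extChartAt 𝓘(ℝ, E) (1 : G) with hφ
  let e : ℝ → G := fun r => lieExp (r • B)
  have he : ContMDiff 𝓘(ℝ, ℝ) 𝓘(ℝ, E) ∞ e := contMDiff_lieExp_smul B
  have he0 : e 0 = 1 := lieExp_zero_smul B
  have heB : ∀ r, HasLeftLogDerivAt e B r := hasLeftLogDerivAt_lieExp B
  let m : ℝ × ℝ × ℝ → G := fun p => β p.1 * e p.2.1 * (β p.2.2)⁻¹
  have hm : ContMDiff 𝓘(ℝ, ℝ × ℝ × ℝ) 𝓘(ℝ, E) ∞ m := by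
    have f1 : ContMDiff 𝓘(ℝ, ℝ × ℝ × ℝ) 𝓘(ℝ, ℝ) ∞ (fun p : ℝ × ℝ × ℝ => p.1) :=
      contDiff_fst.contMDiff
    have f2 : ContMDiff 𝓘(ℝ, ℝ × ℝ × ℝ) 𝓘(ℝ, ℝ) ∞ (fun p : ℝ × ℝ × ℝ => p.2.1) :=
      (contDiff_fst.comp contDiff_snd).contMDiff
    have f3 : ContMDiff 𝓘(ℝ, ℝ × ℝ × ℝ) 𝓘(ℝ, ℝ) ∞ (fun p : ℝ × ℝ × ℝ => p.2.2) :=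
      (contDiff_snd.comp contDiff_snd).contMDiff
    exact ((hβ.comp f1).mul (he.comp f2)).mul (hβ.comp f3).inv
  have hm0 : m 0 = 1 := by simp [m, h1, he0]
  let q : ℝ × ℝ × ℝ → E := fun p => φ (m p)
  have hq : ContDiffAt ℝ 2 q 0 := by
    have hc : ContMDiffAt 𝓘(ℝ, E) 𝓘(ℝ, E) ∞ φ (m 0) := by
      rw [hm0]; exact contMDiffAt_extChartAt
    exact ((hc.comp (0 : ℝ × ℝ × ℝ) hm.contMDiffAt).contDiffAt).of_le ENat.LEInfty.out
  have hqd : ∀ᶠ p in 𝓝 (0 : ℝ × ℝ × ℝ), DifferentiableAt ℝ q p :=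
    (hq.eventually (by simp)).mono fun p hp => hp.differentiableAt (by simp)
  have hq2 : HasFDerivAt (fderiv ℝ q) (fderiv ℝ (fderiv ℝ q) 0) 0 :=
    ((hq.fderiv_right (m := 1) (by norm_num)).differentiableAt (by simp)).hasFDerivAt
  have hsymm : IsSymmSndFDerivAt ℝ q 0 := hq.isSymmSndFDerivAt (by simp)
  -- derivatives of the partial derivatives of `q` along a line through the origin
  have hline : ∀ (v w : ℝ × ℝ × ℝ), HasDerivAt (fun s : ℝ => fderiv ℝ q (s • v) w)
      (fderiv ℝ (fderiv ℝ q) 0 v w) 0 := by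
    intro v w
    have l1 : HasDerivAt (fun s : ℝ => s • v) v 0 := by
      simpa using (hasDerivAt_id (0 : ℝ)).smul_const v
    have l2 := HasFDerivAt.comp_hasDerivAt (0 : ℝ) (l := fderiv ℝ q) (f := fun s : ℝ => s • v)
      (by simpa using hq2) l1
    simpa using l2.clm_apply (hasDerivAt_const (0 : ℝ) w)
  have hlim : ∀ v : ℝ × ℝ × ℝ, Tendsto (fun s : ℝ => s • v) (𝓝 0) (𝓝 0) := by
    intro v
    have : Continuous fun s : ℝ => s • v := by fun_prop
    simpa using this.tendsto 0
  have hpartial : ∀ (p w : ℝ × ℝ × ℝ), DifferentiableAt ℝ q p →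
      HasDerivAt (fun r : ℝ => q (p + r • w)) (fderiv ℝ q p w) 0 := by
    intro p w hp
    have l1 : HasDerivAt (fun r : ℝ => p + r • w) w 0 := by
      simpa using ((hasDerivAt_id (0 : ℝ)).smul_const w).const_add p
    exact HasFDerivAt.comp_hasDerivAt (0 : ℝ) (l := q) (f := fun r : ℝ => p + r • w)
      (by simpa using hp.hasFDerivAt) l1
  have hsrc : ∀ δ : ℝ → G, Continuous δ → δ 0 = 1 → ∀ᶠ s in 𝓝 (0 : ℝ), δ s ∈ φ.source := by
    intro δ hδ hδ0
    exact hδ.continuousAt.eventually (by rw [hδ0]; exact extChartAt_source_mem_nhds 1)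
  -- the three mixed partial derivatives
  have hA : ∀ᶠ s in 𝓝 (0 : ℝ), fderiv ℝ q (s • (1, 0, 1)) (0, 1, 0) = (Ad (β s) B : E) := by
    filter_upwards [(hlim (1, 0, 1)).eventually hqd] with s hs
    have l1 : HasDerivAt (fun r => φ (β s * e r * (β s)⁻¹))
        (fderiv ℝ q (s • (1, 0, 1)) (0, 1, 0)) 0 := by
      simpa [q, m] using hpartial _ (0, 1, 0) hs
    have l2 := ((heB 0).conj (β s)).hasDerivAt_extChartAt (by simp [he0])
    rw [he0, mul_one, mul_inv_cancel, coordField_one_self] at l2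
    exact l1.unique l2
  have hB : ∀ᶠ s in 𝓝 (0 : ℝ), fderiv ℝ q (s • (1, 0, 0)) (0, 1, 0)
      = coordField 1 (mulInvariantVectorField B) (φ (β s)) := by
    filter_upwards [(hlim (1, 0, 0)).eventually hqd, hsrc β hβ.continuous h1] with s hs hs'
    have l1 : HasDerivAt (fun r => φ (β s * e r))
        (fderiv ℝ q (s • (1, 0, 0)) (0, 1, 0)) 0 := by
      simpa [q, m, h1] using hpartial _ (0, 1, 0) hs
    have l2 := ((heB 0).const_mul (β s)).hasDerivAt_extChartAt (by simpa only [he0, mul_one])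
    rw [he0, mul_one] at l2
    exact l1.unique l2
  have hinv : HasLeftLogDerivAt (fun s => (β s)⁻¹) (-U) 0 := by
    have h := hU.inv
    rwa [h1, Ad_one_apply] at h
  have hC : ∀ᶠ s in 𝓝 (0 : ℝ), fderiv ℝ q (s • (0, 1, 0)) (0, 0, 1)
      = -coordField 1 (mulInvariantVectorField U) (φ (e s)) := by
    filter_upwards [(hlim (0, 1, 0)).eventually hqd, hsrc e he.continuous he0] with s hs hs'
    have l1 : HasDerivAt (fun r => φ (e s * (β r)⁻¹))
        (fderiv ℝ q (s • (0, 1, 0)) (0, 0, 1)) 0 := by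
      simpa [q, m, h1] using hpartial _ (0, 0, 1) hs
    have l2 := (hinv.const_mul (e s)).hasDerivAt_extChartAt
      (by simpa only [h1, inv_one, mul_one])
    rw [h1, inv_one, mul_one, coordField_mulInvariantVectorField_neg] at l2
    exact l1.unique l2
  have hfield : ∀ V : GroupLieAlgebra 𝓘(ℝ, E) G,
      DifferentiableAt ℝ (coordField (1 : G) (mulInvariantVectorField V)) (φ 1) := fun V =>
    ((contDiffOn_coordField (1 : G) (contMDiff_infty_mulInvariantVectorField V)).contDiffAt
      (extChartAt_target_mem_nhds 1)).differentiableAt (by simp)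
  have hcomp : ∀ (V W : GroupLieAlgebra 𝓘(ℝ, E) G) (δ : ℝ → G), δ 0 = 1 →
      HasLeftLogDerivAt δ W 0 →
      HasDerivAt (fun s => coordField 1 (mulInvariantVectorField V) (φ (δ s)))
        (fderiv ℝ (coordField (1 : G) (mulInvariantVectorField V)) (φ 1) W) 0 := by
    intro V W δ hδ0 hδ
    have l1 := hδ.hasDerivAt_extChartAt (by rw [hδ0]; exact mem_extChartAt_source 1)
    rw [hδ0, coordField_one_self] at l1
    exact HasFDerivAt.comp_hasDerivAt (0 : ℝ) (f := fun s => φ (δ s))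
      (l := coordField (1 : G) (mulInvariantVectorField V))
      (by rw [hδ0]; exact (hfield V).hasFDerivAt) l1
  have eB := (hline (1, 0, 0) (0, 1, 0)).unique ((hcomp B U β h1 hU).congr_of_eventuallyEq hB)
  have eC := (hline (0, 1, 0) (0, 0, 1)).unique
    ((hcomp U B e he0 (heB 0)).neg.congr_of_eventuallyEq hC)
  have eA := (hline (1, 0, 1) (0, 1, 0)).congr_of_eventuallyEq (hA.mono fun _ h => h.symm)
  have hsum : fderiv ℝ (fderiv ℝ q) 0 (1, 0, 1) (0, 1, 0)
      = ((⁅U, B⁆ : GroupLieAlgebra 𝓘(ℝ, E) G) : E) := by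
    have hs : ((1, 0, 1) : ℝ × ℝ × ℝ) = (1, 0, 0) + (0, 0, 1) := by simp
    rw [hs, map_add, _root_.add_apply, hsymm.eq (0, 0, 1) (0, 1, 0), eB, eC,
      ← sub_eq_add_neg, GroupLieAlgebra.bracket_def, mlieBracket_eq_fderiv_coordField,
      mulInvariantVectorField_one, mulInvariantVectorField_one]
  rwa [hsum] at eA

/-- The derivative of `Ad` along a curve. -/
lemma HasLeftLogDerivAt.hasDerivAt_Ad {β : ℝ → G} (hβ : ContMDiff 𝓘(ℝ, ℝ) 𝓘(ℝ, E) ∞ β) {t : ℝ}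
    {U : GroupLieAlgebra 𝓘(ℝ, E) G} (hU : HasLeftLogDerivAt β U t)
    (B : GroupLieAlgebra 𝓘(ℝ, E) G) :
    HasDerivAt (fun s => (Ad (β s) B : E)) (Ad (β t) ⁅U, B⁆) t := by
  -- Reduction to a curve through `1` at time `0`: `Ad(β(s)) = Ad(β(t)) Ad(δ(s - t))`.
  let δ : ℝ → G := fun s => (β t)⁻¹ * β (s + t)
  have hadd : ContMDiff 𝓘(ℝ, ℝ) 𝓘(ℝ, ℝ) ∞ (fun s : ℝ => s + t) :=
    (contDiff_id.add contDiff_const).contMDiff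
  have hδ : ContMDiff 𝓘(ℝ, ℝ) 𝓘(ℝ, E) ∞ δ := contMDiff_const.mul (hβ.comp hadd)
  have hδ0 : δ 0 = 1 := by simp [δ]
  have hshift : HasLeftLogDerivAt (fun s => β (s + t)) U 0 := by
    have h0 : HasMFDerivAt 𝓘(ℝ, ℝ) 𝓘(ℝ, ℝ) (fun s : ℝ => s + t) 0
        ((1 : ℝ →L[ℝ] ℝ).smulRight (1 : ℝ)) :=
      hasMFDerivAt_smulRight_iff_hasDerivAt.2 (by simpa using (hasDerivAt_id (0 : ℝ)).add_const t)
    have hβd : MDifferentiableAt 𝓘(ℝ, ℝ) 𝓘(ℝ, E) β (0 + t) := hβ.mdifferentiableAt (by simp)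
    have h1 := h0.comp_velocity hβd
    have h2 : (mfderiv 𝓘(ℝ, ℝ) 𝓘(ℝ, E) β (0 + t) (1 : ℝ) : E)
        = mulInvariantVectorField U (β (0 + t)) := by
      have : ∀ t', t' = t → (mfderiv 𝓘(ℝ, ℝ) 𝓘(ℝ, E) β t' (1 : ℝ) : E)
        = mulInvariantVectorField U (β t') := by
        rintro _ rfl
        exact HasMFDerivAt.mfderiv_one hU
      exact this _ (zero_add t)
    exact h1.congr_mfderiv (congrArg (fun w : E => (1 : ℝ →L[ℝ] ℝ).smulRight w) h2)
  have h1 := hasDerivAt_Ad_of_eq_one hδ hδ0 (hshift.const_mul (β t)⁻¹) B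
  let A : E →L[ℝ] E := Ad (E := E) (β t)
  have h2 := A.hasFDerivAt.comp_hasDerivAt (0 : ℝ) h1
  rw [← add_neg_cancel t] at h2
  refine (h2.comp_add_const t (-t)).congr_of_eventuallyEq (Eventually.of_forall fun s => ?_)
  change Ad (β s) B = Ad (β t) (Ad ((β t)⁻¹ * β (s + -t + t)) B)
  rw [← Ad_mul_apply, mul_inv_cancel_left, neg_add_cancel_right]

/-- `Ad a` is an automorphism of the Lie algebra. -/
lemma Ad_bracket (a : G) (U B : GroupLieAlgebra 𝓘(ℝ, E) G) :
    Ad a ⁅U, B⁆ = ⁅Ad a U, Ad a B⁆ := by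
  let β : ℝ → G := fun s => lieExp (s • U)
  have hβ : ContMDiff 𝓘(ℝ, ℝ) 𝓘(ℝ, E) ∞ β := contMDiff_lieExp_smul U
  have hβ0 : β 0 = 1 := lieExp_zero_smul U
  have hU : HasLeftLogDerivAt β U 0 := hasLeftLogDerivAt_lieExp U 0
  have h1 := hasDerivAt_Ad_of_eq_one hβ hβ0 hU B
  let A : E →L[ℝ] E := Ad (E := E) a
  have h2 := A.hasFDerivAt.comp_hasDerivAt (0 : ℝ) h1
  -- `Ad a (Ad(exp(sU)) B) = Ad(a exp(sU) a⁻¹) (Ad a B)`; both sides are differentiated at `s = 0`.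
  have h3 := hasDerivAt_Ad_of_eq_one (β := fun s => a * β s * a⁻¹)
    ((contMDiff_const.mul hβ).mul contMDiff_const) (by simp [hβ0]) (hU.conj a) (Ad a B)
  have h4 : (fun s => A (Ad (β s) B)) = fun s => (Ad (a * β s * a⁻¹) (Ad a B) : E) := by
    ext s
    change Ad a (Ad (β s) B) = Ad (a * β s * a⁻¹) (Ad a B)
    rw [← Ad_mul_apply, ← Ad_mul_apply, inv_mul_cancel_right]
  rw [← h4] at h3
  exact HasDerivAt.unique (F := E) h2 h3

/-- A one-parameter subgroup is commutative, so conjugation by `exp(tX)` fixes the curve `s ↦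
exp(sX)` and hence its velocity. -/
lemma Ad_lieExp_self (X : GroupLieAlgebra 𝓘(ℝ, E) G) (t : ℝ) : Ad (lieExp (t • X)) X = X := by
  have h := (hasLeftLogDerivAt_lieExp X 0).conj (lieExp (t • X))
  have e : (fun s : ℝ => lieExp (t • X) * lieExp (s • X) * (lieExp (t • X))⁻¹)
      = fun s : ℝ => (lieExp (s • X) : G) := by
    ext s
    rw [← lieExp_add_smul, add_comm, lieExp_add_smul, mul_inv_cancel_right]
  rw [e] at h
  exact h.unique (hasLeftLogDerivAt_lieExp X 0)

end AdDeriv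

/-! ### First variation of energy in a vector space -/

section FirstVariation

open Set Filter Topology

variable {F : Type*} [NormedAddCommGroup F] [NormedSpace ℝ F]

lemma hasDerivAt_bilin {h : F → F →L[ℝ] F →L[ℝ] ℝ} {c a b : ℝ → F} {c' a' b' : F} {r : ℝ}
    (hh : DifferentiableAt ℝ h (c r)) (hc : HasDerivAt c c' r) (ha : HasDerivAt a a' r)
    (hb : HasDerivAt b b' r) :
    HasDerivAt (fun s => h (c s) (a s) (b s))
      (fderiv ℝ h (c r) c' (a r) (b r) + h (c r) a' (b r) + h (c r) (a r) b') r := by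
  have h0 : HasDerivAt (fun s => h (c s)) (fderiv ℝ h (c r) c') r :=
    HasFDerivAt.comp_hasDerivAt (l := h) (f := c) r hh.hasFDerivAt hc
  have h1 : HasDerivAt (fun s => h (c s) (a s)) (fderiv ℝ h (c r) c' (a r) + h (c r) a') r :=
    h0.clm_apply ha
  exact h1.clm_apply hb

/-- The first variation of the energy density `½ h(∂ₜf, ∂ₜf)` of a variation `f` of the curve
`f (0, ·)`. -/
lemma exists_hasDerivAt_energy_variation {h : F → F →L[ℝ] F →L[ℝ] ℝ} {f : ℝ × ℝ → F} {t₀ : ℝ}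
    (hf : ContDiffAt ℝ 2 f (0, t₀)) (hh : DifferentiableAt ℝ h (f (0, t₀)))
    (hsymm : ∀ u v, h (f (0, t₀)) u v = h (f (0, t₀)) v u) :
    ∃ n b : ℝ,
      HasDerivAt (fun s : ℝ => h (f (s, t₀)) (fderiv ℝ f (s, t₀) (0, 1))
        (fderiv ℝ f (s, t₀) (0, 1))) n 0 ∧
      HasDerivAt (fun t : ℝ => h (f (0, t)) (fderiv ℝ f (0, t) (1, 0))
        (fderiv ℝ f (0, t) (0, 1))) b t₀ ∧
      HasDerivAt (fun t : ℝ => fderiv ℝ f (0, t) (0, 1))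
        (fderiv ℝ (fderiv ℝ f) (0, t₀) (0, 1) (0, 1)) t₀ ∧
      b - 1 / 2 * n = h (f (0, t₀)) (fderiv ℝ f (0, t₀) (1, 0))
          (fderiv ℝ (fderiv ℝ f) (0, t₀) (0, 1) (0, 1))
        + fderiv ℝ h (f (0, t₀)) (fderiv ℝ f (0, t₀) (0, 1)) (fderiv ℝ f (0, t₀) (1, 0))
          (fderiv ℝ f (0, t₀) (0, 1))
        - 1 / 2 * fderiv ℝ h (f (0, t₀)) (fderiv ℝ f (0, t₀) (1, 0)) (fderiv ℝ f (0, t₀) (0, 1))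
          (fderiv ℝ f (0, t₀) (0, 1)) := by
  have hf1 : HasFDerivAt f (fderiv ℝ f (0, t₀)) (0, t₀) :=
    (hf.differentiableAt (by simp)).hasFDerivAt
  have hf2 : HasFDerivAt (fderiv ℝ f) (fderiv ℝ (fderiv ℝ f) (0, t₀)) (0, t₀) :=
    ((hf.fderiv_right (m := 1) (by norm_num)).differentiableAt (by simp)).hasFDerivAt
  have hs : HasDerivAt (fun s : ℝ => (s, t₀)) ((1, 0) : ℝ × ℝ) 0 :=
    (hasDerivAt_id _).prodMk (hasDerivAt_const _ _)
  have ht : HasDerivAt (fun t : ℝ => ((0 : ℝ), t)) ((0, 1) : ℝ × ℝ) t₀ :=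
    (hasDerivAt_const _ _).prodMk (hasDerivAt_id _)
  have hfs := HasFDerivAt.comp_hasDerivAt (f := fun s : ℝ => (s, t₀)) (0 : ℝ) hf1 hs
  have hft := HasFDerivAt.comp_hasDerivAt (f := fun t : ℝ => ((0 : ℝ), t)) t₀ hf1 ht
  have hfst : HasDerivAt (fun s : ℝ => fderiv ℝ f (s, t₀) (0, 1))
      (fderiv ℝ (fderiv ℝ f) (0, t₀) (1, 0) (0, 1)) 0 := by
    simpa using (HasFDerivAt.comp_hasDerivAt (f := fun s : ℝ => (s, t₀)) (0 : ℝ) hf2 hs).clm_apply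
      (hasDerivAt_const (0 : ℝ) ((0, 1) : ℝ × ℝ))
  have hftw : ∀ w : ℝ × ℝ, HasDerivAt (fun t : ℝ => fderiv ℝ f (0, t) w)
      (fderiv ℝ (fderiv ℝ f) (0, t₀) (0, 1) w) t₀ := by
    intro w
    simpa using (HasFDerivAt.comp_hasDerivAt (f := fun t : ℝ => ((0 : ℝ), t)) t₀ hf2 ht).clm_apply
      (hasDerivAt_const t₀ w)
  refine ⟨_, _, hasDerivAt_bilin hh hfs hfst hfst, hasDerivAt_bilin hh hft (hftw _) (hftw _),
    hftw _, ?_⟩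
  -- Both `b` and `n / 2` contain the term `h(∂ₛ∂ₜf, ∂ₜf)`, once the mixed partials are identified;
  -- it cancels.
  have hmix := (hf.isSymmSndFDerivAt (by simp)).eq (1, 0) (0, 1)
  rw [hmix, hsymm (fderiv ℝ f (0, t₀) (0, 1))]
  ring

end FirstVariation

/-! ### Inverse Gram matrices -/

section LinearAlgebra

variable {F : Type*} [AddCommGroup F] [Module ℝ F] {ι : Type*} [Fintype ι] [DecidableEq ι]

/-- Raising an index with the inverse Gram matrix and lowering it again. -/
lemma sum_mul_inv_gram_mulVec (e : Module.Basis ι ℝ F) (b : F →ₗ[ℝ] F →ₗ[ℝ] ℝ)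
    (hb : ∀ u, b u u = 0 → u = 0) (w : F) (c : ι → ℝ) :
    ∑ k, b w (e k) * ∑ l, (Matrix.of fun i j => b (e i) (e j))⁻¹ k l * c l
      = ∑ l, e.coord l w * c l := by
  set A : Matrix ι ι ℝ := Matrix.of fun i j => b (e i) (e j) with hA
  have hdet : A.det ≠ 0 := by
    intro h0
    obtain ⟨x, hx, hAx⟩ := Matrix.exists_mulVec_eq_zero_iff.2 h0
    -- A kernel vector of the Gram matrix gives a null vector of the form, excluded by definiteness.
    have h1 : b (∑ i, x i • e i) (∑ i, x i • e i) = 0 := by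
      have h2 : ∀ i, b (e i) (∑ j, x j • e j) = 0 := by
        intro i
        have := congrFun hAx i
        simpa [Matrix.mulVec, dotProduct, hA, mul_comm] using this
      have h3 : ∀ v, (∀ i, b (e i) v = 0) → b (∑ i, x i • e i) v = 0 := by
        intro v hv
        simp [hv]
      exact h3 _ h2
    have h3 := hb _ h1
    apply hx
    ext i
    have := congrArg (fun u => e.coord i u) h3
    simpa [Finsupp.single_apply] using this
  have hinv : A * A⁻¹ = 1 := Matrix.mul_nonsing_inv A (isUnit_iff_ne_zero.2 hdet)
  have hw : ∀ k, b w (e k) = ∑ i, e.coord i w * A i k := by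
    intro k
    have : b w (e k) = b (∑ i, e.repr w i • e i) (e k) := by rw [e.sum_repr]
    rw [this]
    simp only [map_sum, map_smul, LinearMap.sum_apply, LinearMap.smul_apply, smul_eq_mul,
      Module.Basis.coord_apply, hA, Matrix.of_apply]
  have : ∀ i, ∑ k, A i k * ∑ l, A⁻¹ k l * c l = c i := by
    intro i
    have h := congrFun (congrArg (fun B : Matrix ι ι ℝ => B.mulVec c) hinv) i
    simpa only [← Matrix.mulVec_mulVec, Matrix.one_mulVec] using! h
  simp only [hw, Finset.sum_mul, mul_assoc]
  rw [Finset.sum_comm]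
  simp only [← Finset.mul_sum, this]

end LinearAlgebra

/-! ### The metric and its Christoffel symbols in a chart -/

section Metric

open Set Filter Topology

variable {F : Type*} [NormedAddCommGroup F] [NormedSpace ℝ F] [FiniteDimensional ℝ F]
  {M : Type*} [TopologicalSpace M] [ChartedSpace F M] [IsManifold 𝓘(ℝ, F) ∞ M]
  (g : Bundle.ContMDiffRiemannianMetric 𝓘(ℝ, F) ∞ F (fun x : M => TangentSpace 𝓘(ℝ, F) x))
  (p : M)

omit [FiniteDimensional ℝ F] in
lemma mfderiv_extChartAt_comp_symm {y : F} (hy : y ∈ (extChartAt 𝓘(ℝ, F) p).target) (u : F) :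
    (mfderiv 𝓘(ℝ, F) 𝓘(ℝ, F) (extChartAt 𝓘(ℝ, F) p) ((extChartAt 𝓘(ℝ, F) p).symm y)
      (mfderiv 𝓘(ℝ, F) 𝓘(ℝ, F) (extChartAt 𝓘(ℝ, F) p).symm y u) : F) = u := by
  have : IsManifold 𝓘(ℝ, F) 1 M := .of_le (n := ∞) (by exact_mod_cast le_top)
  have h := mfderiv_extChartAt_comp_mfderivWithin_extChartAt_symm (I := 𝓘(ℝ, F)) hy
  rw [modelWithCornersSelf_coe, range_id, mfderivWithin_univ] at h
  exact congrArg (fun A : F →L[ℝ] F => A u) h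

omit [FiniteDimensional ℝ F] in
lemma mfderiv_extChartAt_symm_comp {x : M} (hx : x ∈ (extChartAt 𝓘(ℝ, F) p).source) (u : F) :
    (mfderiv 𝓘(ℝ, F) 𝓘(ℝ, F) (extChartAt 𝓘(ℝ, F) p).symm (extChartAt 𝓘(ℝ, F) p x)
      (mfderiv 𝓘(ℝ, F) 𝓘(ℝ, F) (extChartAt 𝓘(ℝ, F) p) x u) : F) = u := by
  have : IsManifold 𝓘(ℝ, F) 1 M := .of_le (n := ∞) (by exact_mod_cast le_top)
  have h := mfderivWithin_extChartAt_symm_comp_mfderiv_extChartAt' (I := 𝓘(ℝ, F)) hx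
  rw [modelWithCornersSelf_coe, range_id, mfderivWithin_univ] at h
  exact congrArg (fun A : F →L[ℝ] F => A u) h

/-- In the trivialization at `p` this field is a constant basis vector. -/
lemma contMDiffAt_coordVector (i : Fin (Module.finrank ℝ F)) {y : F}
    (hy : y ∈ (extChartAt 𝓘(ℝ, F) p).target) :
    ContMDiffAt 𝓘(ℝ, F) 𝓘(ℝ, F).tangent ∞
      (fun y => (⟨(extChartAt 𝓘(ℝ, F) p).symm y, coordVector p i y⟩ : TangentBundle 𝓘(ℝ, F) M))
      y := by
  have : IsManifold 𝓘(ℝ, F) 1 M := .of_le (n := ∞) (by exact_mod_cast le_top)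
  have hopen : IsOpen (extChartAt 𝓘(ℝ, F) p).target := isOpen_extChartAt_target p
  have hmaps : ∀ y ∈ (extChartAt 𝓘(ℝ, F) p).target,
      (extChartAt 𝓘(ℝ, F) p).symm y ∈ (chartAt F p).source := fun y hy => by
    simpa only [extChartAt_source] using (extChartAt 𝓘(ℝ, F) p).map_target hy
  rw [Bundle.Trivialization.contMDiffAt_iff
    (IB := 𝓘(ℝ, F)) (e := trivializationAt F (TangentSpace 𝓘(ℝ, F)) p)
    (by simpa using hmaps y hy)]
  refine ⟨(contMDiffOn_extChartAt_symm p).contMDiffAt (hopen.mem_nhds hy), ?_⟩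
  refine (contMDiffAt_const (c := Module.finBasis ℝ F i)).congr_of_eventuallyEq ?_
  filter_upwards [hopen.mem_nhds hy] with z hz
  refine Eq.trans ?_ (mfderiv_extChartAt_comp_symm p hz (Module.finBasis ℝ F i))
  rw [← TangentBundle.continuousLinearMapAt_trivializationAt (hmaps z hz)]
  exact (Bundle.Trivialization.continuousLinearMapAt_apply_of_mem ℝ
    (trivializationAt F (TangentSpace 𝓘(ℝ, F)) p) (by simpa using hmaps z hz) _).symm

/-- The metric, a smooth section of the bundle of bilinear forms, is evaluated on two smooth
coordinate fields. -/
lemma differentiableAt_metricCoeff (i j : Fin (Module.finrank ℝ F)) {y : F}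
    (hy : y ∈ (extChartAt 𝓘(ℝ, F) p).target) : DifferentiableAt ℝ (metricCoeff g p i j) y := by
  have hg : ContMDiffAt 𝓘(ℝ, F) (𝓘(ℝ, F).prod 𝓘(ℝ, F →L[ℝ] F →L[ℝ] ℝ)) ∞
      (fun z : F => (⟨(extChartAt 𝓘(ℝ, F) p).symm z, g.inner ((extChartAt 𝓘(ℝ, F) p).symm z)⟩ :
        Bundle.TotalSpace (F →L[ℝ] F →L[ℝ] ℝ) (fun x : M =>
          TangentSpace 𝓘(ℝ, F) x →L[ℝ] TangentSpace 𝓘(ℝ, F) x →L[ℝ] ℝ))) y :=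
    (g.contMDiff _).comp y ((contMDiffOn_extChartAt_symm p).contMDiffAt
      ((isOpen_extChartAt_target p).mem_nhds hy))
  have h := ContMDiffAt.clm_bundle_apply₂ (F₁ := F) (F₂ := F) (F₃ := ℝ)
    (E₁ := fun x : M => TangentSpace 𝓘(ℝ, F) x) (E₂ := fun x : M => TangentSpace 𝓘(ℝ, F) x)
    (E₃ := Bundle.Trivial M ℝ) hg
    (contMDiffAt_coordVector p i hy) (contMDiffAt_coordVector p j hy)
  have h2 := (Bundle.contMDiffAt_totalSpace.1 h).2.contDiffAt
  exact h2.differentiableAt (by simp)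

omit [FiniteDimensional ℝ F] in
lemma differentiableAt_sum_sum_smul {ι V : Type*} [Fintype ι] [NormedAddCommGroup V]
    [NormedSpace ℝ V] {c : ι → ι → F → ℝ} {y : F} (hc : ∀ i j, DifferentiableAt ℝ (c i j) y)
    (B : ι → ι → V) : DifferentiableAt ℝ (fun y => ∑ i, ∑ j, c i j y • B i j) y :=
  DifferentiableAt.fun_sum fun i _ => DifferentiableAt.fun_sum fun j _ => (hc i j).smul_const _

/-- The product of two coordinate forms, as a bilinear form. -/
noncomputable def coordForm (i j : Fin (Module.finrank ℝ F)) : F →L[ℝ] F →L[ℝ] ℝ :=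
  (LinearMap.toContinuousLinearMap ((Module.finBasis ℝ F).coord i)).smulRight
    (LinearMap.toContinuousLinearMap ((Module.finBasis ℝ F).coord j))

/-- The Riemannian metric as a bilinear form depending on the coordinates of the chart at `p`. -/
noncomputable def coordMetric (y : F) : F →L[ℝ] F →L[ℝ] ℝ :=
  ∑ i, ∑ j, metricCoeff g p i j y • coordForm i j

lemma coordMetric_apply (y u v : F) :
    coordMetric g p y u v = ∑ i, ∑ j, metricCoeff g p i j y *
      ((Module.finBasis ℝ F).coord i u * (Module.finBasis ℝ F).coord j v) := by
  simp [coordMetric, coordForm]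

lemma coordMetric_eq_inner (y u v : F) :
    coordMetric g p y u v = g.inner ((extChartAt 𝓘(ℝ, F) p).symm y)
      (mfderiv 𝓘(ℝ, F) 𝓘(ℝ, F) (extChartAt 𝓘(ℝ, F) p).symm y u)
      (mfderiv 𝓘(ℝ, F) 𝓘(ℝ, F) (extChartAt 𝓘(ℝ, F) p).symm y v) := by
  let A : F →L[ℝ] F := mfderiv 𝓘(ℝ, F) 𝓘(ℝ, F) (extChartAt 𝓘(ℝ, F) p).symm y
  let b : F →L[ℝ] F →L[ℝ] ℝ := g.inner ((extChartAt 𝓘(ℝ, F) p).symm y)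
  have key : ∀ u v : F, ∑ i, ∑ j, b (A (Module.finBasis ℝ F i)) (A (Module.finBasis ℝ F j)) *
      ((Module.finBasis ℝ F).coord i u * (Module.finBasis ℝ F).coord j v) = b (A u) (A v) := by
    intro u v
    conv_rhs =>
      rw [← (Module.finBasis ℝ F).sum_repr u, ← (Module.finBasis ℝ F).sum_repr v]
    simp only [map_sum, map_smul, _root_.sum_apply, _root_.smul_apply, smul_eq_mul,
      Module.Basis.coord_apply]
    rw [Finset.sum_comm]
    refine Finset.sum_congr rfl fun i _ => ?_
    rw [Finset.mul_sum]
    refine Finset.sum_congr rfl fun j _ => ?_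
    ring
  rw [coordMetric_apply]
  exact key u v

lemma coordMetric_finBasis (i j : Fin (Module.finrank ℝ F)) (y : F) :
    coordMetric g p y (Module.finBasis ℝ F i) (Module.finBasis ℝ F j) = metricCoeff g p i j y :=
  coordMetric_eq_inner g p y _ _

lemma coordMetric_symm (y u v : F) : coordMetric g p y u v = coordMetric g p y v u := by
  rw [coordMetric_eq_inner, coordMetric_eq_inner, g.symm]

lemma differentiableAt_coordMetric {y : F} (hy : y ∈ (extChartAt 𝓘(ℝ, F) p).target) :
    DifferentiableAt ℝ (coordMetric g p) y := by
  exact differentiableAt_sum_sum_smul (fun i j => differentiableAt_metricCoeff g p i j hy)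
    (coordForm (F := F))

lemma coordMetric_mfderiv_extChartAt {x : M} (hx : x ∈ (extChartAt 𝓘(ℝ, F) p).source)
    (u v : TangentSpace 𝓘(ℝ, F) x) :
    coordMetric g p (extChartAt 𝓘(ℝ, F) p x)
      (mfderiv 𝓘(ℝ, F) 𝓘(ℝ, F) (extChartAt 𝓘(ℝ, F) p) x u)
      (mfderiv 𝓘(ℝ, F) 𝓘(ℝ, F) (extChartAt 𝓘(ℝ, F) p) x v) = g.inner x u v := by
  refine (coordMetric_eq_inner g p _ _ _).trans ?_
  have aux : ∀ x' : M, x' = x → ∀ u' v' : F, u' = u → v' = v →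
      g.inner x' (u' : F) (v' : F) = g.inner x u v := by
    rintro x' rfl u' v' rfl rfl
    rfl
  exact aux _ ((extChartAt 𝓘(ℝ, F) p).left_inv hx) _ _ (mfderiv_extChartAt_symm_comp p hx u)
    (mfderiv_extChartAt_symm_comp p hx v)

lemma coordMetric_self (u v : TangentSpace 𝓘(ℝ, F) p) :
    coordMetric g p (extChartAt 𝓘(ℝ, F) p p) u v = g.inner p u v := by
  have : IsManifold 𝓘(ℝ, F) 1 M := .of_le (n := ∞) (by exact_mod_cast le_top)
  have h := coordMetric_mfderiv_extChartAt g p (mem_extChartAt_source p) u v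
  rwa [mfderiv_extChartAt_self] at h

lemma coordVector_self (i : Fin (Module.finrank ℝ F)) :
    (coordVector p i (extChartAt 𝓘(ℝ, F) p p) : F) = Module.finBasis ℝ F i := by
  have : IsManifold 𝓘(ℝ, F) 1 M := .of_le (n := ∞) (by exact_mod_cast le_top)
  have h := mfderiv_extChartAt_symm_comp p (mem_extChartAt_source p) (Module.finBasis ℝ F i)
  rwa [mfderiv_extChartAt_self] at h

lemma fderiv_metricCoeff (i j : Fin (Module.finrank ℝ F)) {y : F}
    (hy : y ∈ (extChartAt 𝓘(ℝ, F) p).target) (a : F) :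
    fderiv ℝ (metricCoeff g p i j) y a
      = fderiv ℝ (coordMetric g p) y a (Module.finBasis ℝ F i) (Module.finBasis ℝ F j) := by
  have h0 := (differentiableAt_coordMetric g p hy).hasFDerivAt
  have h1 := (h0.clm_apply (hasFDerivAt_const (Module.finBasis ℝ F i) y)).clm_apply
    (hasFDerivAt_const (Module.finBasis ℝ F j) y)
  have h2 : (fun y => coordMetric g p y (Module.finBasis ℝ F i) (Module.finBasis ℝ F j))
      = metricCoeff g p i j := funext fun y => coordMetric_finBasis g p i j y
  rw [h2] at h1
  rw [h1.fderiv]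
  simp

lemma fderiv_coordMetric_symm {y : F} (hy : y ∈ (extChartAt 𝓘(ℝ, F) p).target) (a u v : F) :
    fderiv ℝ (coordMetric g p) y a u v = fderiv ℝ (coordMetric g p) y a v u := by
  have h0 := (differentiableAt_coordMetric g p hy).hasFDerivAt
  have h1 := (h0.clm_apply (hasFDerivAt_const u y)).clm_apply (hasFDerivAt_const v y)
  have h2 := (h0.clm_apply (hasFDerivAt_const v y)).clm_apply (hasFDerivAt_const u y)
  have h3 : (fun y => coordMetric g p y u v) = fun y => coordMetric g p y v u :=
    funext fun y => coordMetric_symm g p y u v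
  rw [h3] at h1
  have h4 := congrArg (fun L : F →L[ℝ] ℝ => L a) (h1.unique h2)
  simpa using h4

/-- The defining property of the Christoffel symbols of the Levi-Civita connection. -/
lemma coordMetric_sum_christoffel (w v a : F) :
    coordMetric g p (extChartAt 𝓘(ℝ, F) p p) w
      (∑ k, ((Module.finBasis ℝ F).coord k a
        + ∑ i, ∑ j, christoffel g p k i j (extChartAt 𝓘(ℝ, F) p p)
          * (Module.finBasis ℝ F).coord i v * (Module.finBasis ℝ F).coord j v) •
        Module.finBasis ℝ F k)
    = coordMetric g p (extChartAt 𝓘(ℝ, F) p p) w a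
      + fderiv ℝ (coordMetric g p) (extChartAt 𝓘(ℝ, F) p p) v w v
      - 1 / 2 * fderiv ℝ (coordMetric g p) (extChartAt 𝓘(ℝ, F) p p) w v v := by
  set y := extChartAt 𝓘(ℝ, F) p p with hy
  set e := Module.finBasis ℝ F with he
  set b := coordMetric g p y with hb
  set D := fderiv ℝ (coordMetric g p) y with hD
  have hyt : y ∈ (extChartAt 𝓘(ℝ, F) p).target := mem_extChartAt_target p
  have hpos : ∀ u, b u u = 0 → u = 0 := by
    intro u hu
    by_contra hne
    have h1 := g.pos p (u : F) hne
    rw [← coordMetric_self g p (u : F) (u : F)] at h1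
    exact h1.ne' hu
  -- Pairing with `w` lowers the index that the inverse matrix in `christoffel` raises.
  have hlower : ∀ (c : _ → ℝ),
      ∑ k, b w (e k) * ∑ l, (Matrix.of fun a b => metricCoeff g p a b y)⁻¹ k l * c l
        = ∑ l, e.coord l w * c l := by
    intro c
    have h := sum_mul_inv_gram_mulVec e (ContinuousLinearMap.toLinearMap₁₂ b) hpos w c
    have hm : (Matrix.of fun a b => metricCoeff g p a b y)
        = Matrix.of fun i j => ContinuousLinearMap.toLinearMap₁₂ b (e i) (e j) := by
      ext i j
      exact (coordMetric_finBasis g p i j y).symm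
    rw [hm]
    exact h
  have hexp : ∀ (L : F →L[ℝ] ℝ) (u : F), ∑ i, L (e i) * e.coord i u = L u := by
    intro L u
    have h : L u = L (∑ i, e.repr u i • e i) := by rw [e.sum_repr]
    rw [h]
    simp only [map_sum, map_smul, smul_eq_mul, Module.Basis.coord_apply, mul_comm]
  have hexp₂ : ∀ (L : F →L[ℝ] F →L[ℝ] ℝ),
      ∑ i, ∑ j, L (e i) (e j) * (e.coord i v * e.coord j v) = L v v := by
    intro L
    rw [← L.flip_apply v v, ← hexp (L.flip v) v]
    refine Finset.sum_congr rfl fun i _ => ?_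
    rw [ContinuousLinearMap.flip_apply, ← hexp (L (e i)) v, Finset.sum_mul]
    exact Finset.sum_congr rfl fun j _ => by ring
  -- Contracted with `v` twice, the terms `∂ᵢ gⱼₗ` and `∂ⱼ gᵢₗ` become equal, which absorbs the
  -- factor `1 / 2` in front of them.
  have hC : ∀ l, ∑ i, ∑ j, (1 / 2 * (fderiv ℝ (metricCoeff g p j l) y (e i)
      + fderiv ℝ (metricCoeff g p i l) y (e j) - fderiv ℝ (metricCoeff g p i j) y (e l)))
        * (e.coord i v * e.coord j v) = D v v (e l) - 1 / 2 * D (e l) v v := by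
    intro l
    let Q : F →L[ℝ] F →L[ℝ] ℝ := ((ContinuousLinearMap.apply ℝ ℝ (e l)).postcomp F).comp D
    have hQ : ∀ x z, Q x z = D x z (e l) := fun x z => rfl
    have h1 := hexp₂ Q
    have h2 := hexp₂ Q.flip
    have h3 := hexp₂ (D (e l))
    simp only [ContinuousLinearMap.flip_apply, hQ] at h1 h2
    have h4 : D v v (e l) - 1 / 2 * D (e l) v v
        = 1 / 2 * (D v v (e l) + D v v (e l) - D (e l) v v) := by ring
    rw [h4]
    calc _ = ∑ i, ∑ j, 1 / 2 * (D (e i) (e j) (e l) * (e.coord i v * e.coord j v)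
          + D (e j) (e i) (e l) * (e.coord i v * e.coord j v)
          - D (e l) (e i) (e j) * (e.coord i v * e.coord j v)) := by
          refine Finset.sum_congr rfl fun i _ => Finset.sum_congr rfl fun j _ => ?_
          rw [fderiv_metricCoeff g p j l hyt, fderiv_metricCoeff g p i l hyt,
            fderiv_metricCoeff g p i j hyt]
          ring
      _ = _ := by
          simp only [← Finset.mul_sum, Finset.sum_add_distrib, Finset.sum_sub_distrib]
          rw [h1, h2, h3]
  have hS : ∀ k, ∑ i, ∑ j, christoffel g p k i j y * e.coord i v * e.coord j v
      = ∑ l, (Matrix.of fun a b => metricCoeff g p a b y)⁻¹ k l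
        * (D v v (e l) - 1 / 2 * D (e l) v v) := by
    intro k
    simp only [← hC, christoffel, Finset.mul_sum, Finset.sum_mul]
    refine Eq.trans (Finset.sum_congr rfl fun i _ => Finset.sum_comm) ?_
    rw [Finset.sum_comm]
    refine Finset.sum_congr rfl fun l _ => Finset.sum_congr rfl fun i _ =>
      Finset.sum_congr rfl fun j _ => ?_
    ring
  have hw₁ : ∑ l, D v v (e l) * e.coord l w = D v v w := hexp (D v v) w
  have hw₂ : ∑ l, D (e l) v v * e.coord l w = D w v v := by
    have h := hexp ((D.flip v).flip v) w
    simpa only [ContinuousLinearMap.flip_apply] using h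
  have ha : ∑ k, b w (e k) * e.coord k a = b w a := hexp (b w) a
  rw [fderiv_coordMetric_symm g p hyt v w v]
  calc _ = ∑ k, b w (e k) * e.coord k a + ∑ k, b w (e k) *
        ∑ i, ∑ j, christoffel g p k i j y * e.coord i v * e.coord j v := by
        simp only [map_sum, map_smul, smul_eq_mul]
        rw [← Finset.sum_add_distrib]
        exact Finset.sum_congr rfl fun k _ => by ring
    _ = b w a + (∑ l, D v v (e l) * e.coord l w - 1 / 2 * ∑ l, D (e l) v v * e.coord l w) := by
        simp only [hS, hlower, ha]
        rw [Finset.mul_sum, ← Finset.sum_sub_distrib]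
        exact congrArg _ (Finset.sum_congr rfl fun k _ => by ring)
    _ = _ := by
        rw [hw₁, hw₂]
        ring

end Metric

/-! ### Orbit curves and translation of vectors -/

section Action

open Set Filter Topology

variable {E : Type*} [NormedAddCommGroup E] [NormedSpace ℝ E]
  {G : Type*} [TopologicalSpace G] [ChartedSpace E G] [Group G] [LieGroup 𝓘(ℝ, E) ∞ G]
  {F : Type*} [NormedAddCommGroup F] [NormedSpace ℝ F]
  {M : Type*} [TopologicalSpace M] [ChartedSpace F M] [IsManifold 𝓘(ℝ, F) ∞ M]
  [MulAction G M] [ContMDiffSMul 𝓘(ℝ, E) 𝓘(ℝ, F) ∞ G M]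

variable (E F G) in
omit [LieGroup 𝓘(ℝ, E) ∞ G] [IsManifold 𝓘(ℝ, F) ∞ M] in
lemma contMDiff_orbit (o : M) : ContMDiff 𝓘(ℝ, E) 𝓘(ℝ, F) ∞ (fun b : G => b • o) :=
  (contMDiff_smul (I := 𝓘(ℝ, E)) (I' := 𝓘(ℝ, F)) (n := ∞) (G := G) (M := M)).comp
    (contMDiff_id.prodMk contMDiff_const)

omit [IsManifold 𝓘(ℝ, F) ∞ M] in
/-- The vector `Ŵ` is the translate of `W_𝔪`. -/
lemma hatField_eq_mfderiv_smul (o : M) (W : GroupLieAlgebra 𝓘(ℝ, E) G) (a : G) :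
    (hatField o W a : F) = mfderiv 𝓘(ℝ, F) 𝓘(ℝ, F) (fun x : M => a • x) o (projO o W) := by
  have aux₁ : ∀ b : G, b = a → ∀ w : E,
      (mfderiv 𝓘(ℝ, E) 𝓘(ℝ, F) (fun b : G => b • o) a : E →L[ℝ] F) w
        = (mfderiv 𝓘(ℝ, E) 𝓘(ℝ, F) (fun b : G => b • o) b : E →L[ℝ] F) w := by
    rintro b rfl w
    rfl
  have aux₂ : ∀ x : M, x = o → ∀ w : F,
      (mfderiv 𝓘(ℝ, F) 𝓘(ℝ, F) (fun x : M => a • x) o : F →L[ℝ] F) w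
        = (mfderiv 𝓘(ℝ, F) 𝓘(ℝ, F) (fun x : M => a • x) x : F →L[ℝ] F) w := by
    rintro x rfl w
    rfl
  -- Equivariance of the projection, `π(ab) = a · π(b)`, differentiated at `b = 1`.
  have h1 : (fun b : G => b • o) ∘ (fun b : G => a * b)
      = (fun x : M => a • x) ∘ (fun b : G => b • o) := by
    ext b; simp [mul_smul]
  have h2 := mfderiv_congr (I := 𝓘(ℝ, E)) (I' := 𝓘(ℝ, F)) (x := 1) h1
  have hsmul : ContMDiff 𝓘(ℝ, F) 𝓘(ℝ, F) ∞ (fun x : M => a • x) :=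
    (contMDiff_smul (I := 𝓘(ℝ, E)) (I' := 𝓘(ℝ, F)) (n := ∞) (G := G) (M := M)).comp
      (contMDiff_const.prodMk contMDiff_id)
  rw [mfderiv_comp (I' := 𝓘(ℝ, E)) _ ((contMDiff_orbit E G F o).mdifferentiableAt (by simp))
    (mdifferentiableAt_mul_left_infty a 1), mfderiv_comp (I' := 𝓘(ℝ, F)) _
    (hsmul.mdifferentiableAt (by simp))
    ((contMDiff_orbit E G F o).mdifferentiableAt (by simp))] at h2
  have h3 := congrArg (fun A : E →L[ℝ] F => A W) h2
  refine (aux₁ _ (mul_one a) _).trans (h3.trans ?_)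
  exact (aux₂ _ (one_smul G o) _).symm

omit [LieGroup 𝓘(ℝ, E) ∞ G] [IsManifold 𝓘(ℝ, F) ∞ M] in
/-- The velocity of the orbit curve `β · o`. -/
lemma HasLeftLogDerivAt.smul {β : ℝ → G} {U : GroupLieAlgebra 𝓘(ℝ, E) G} {t : ℝ}
    (hβ : HasLeftLogDerivAt β U t) (o : M) :
    HasMFDerivAt 𝓘(ℝ, ℝ) 𝓘(ℝ, F) (fun s => β s • o) t
      ((1 : ℝ →L[ℝ] ℝ).smulRight (hatField o U (β t))) :=
  HasMFDerivAt.comp_velocity hβ ((contMDiff_orbit E G F o).mdifferentiableAt (by simp))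

omit [LieGroup 𝓘(ℝ, E) ∞ G] in
lemma HasLeftLogDerivAt.hasDerivAt_extChartAt_smul {β : ℝ → G}
    {U : GroupLieAlgebra 𝓘(ℝ, E) G} {t : ℝ} (hβ : HasLeftLogDerivAt β U t) (o p : M)
    (ht : β t • o ∈ (extChartAt 𝓘(ℝ, F) p).source) :
    HasDerivAt (fun s => extChartAt 𝓘(ℝ, F) p (β s • o))
      (mfderiv 𝓘(ℝ, F) 𝓘(ℝ, F) (extChartAt 𝓘(ℝ, F) p) (β t • o) (hatField o U (β t))) t := by
  have : IsManifold 𝓘(ℝ, F) 1 M := .of_le (n := ∞) (by exact_mod_cast le_top)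
  exact hasMFDerivAt_smulRight_iff_hasDerivAt.1
    (HasMFDerivAt.comp_velocity (hβ.smul o) (mdifferentiableAt_extChartAt
      (by rw [← extChartAt_source 𝓘(ℝ, F)]; exact ht)))

variable {g : Bundle.ContMDiffRiemannianMetric 𝓘(ℝ, F) ∞ F (fun x : M => TangentSpace 𝓘(ℝ, F) x)}

/-- Both vectors are translates by `a` of vectors at `o`. It turns inner products along the curve
into inner products in the fixed space `T_o M`. -/
lemma inner_hatField (hg : IsInvariantMetric G g) (o : M) (V W : GroupLieAlgebra 𝓘(ℝ, E) G)
    (a : G) :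
    g.inner (a • o) (hatField o V a) (hatField o W a) = g.inner o (projO o V) (projO o W) := by
  rw [← hg a o]
  exact congrArg₂ (fun u v : F => g.inner (a • o) u v) (hatField_eq_mfderiv_smul o V a)
    (hatField_eq_mfderiv_smul o W a)

end Action

/-! ### The acceleration of an orbit curve -/

section Acceleration

open Set Filter Topology

variable {E : Type*} [NormedAddCommGroup E] [NormedSpace ℝ E] [CompleteSpace E]
  {G : Type*} [TopologicalSpace G] [T2Space G] [ChartedSpace E G] [Group G]
  [LieGroup 𝓘(ℝ, E) ∞ G]
  {F : Type*} [NormedAddCommGroup F] [NormedSpace ℝ F] [FiniteDimensional ℝ F]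
  {M : Type*} [TopologicalSpace M] [ChartedSpace F M] [IsManifold 𝓘(ℝ, F) ∞ M]
  [MulAction G M] [ContMDiffSMul 𝓘(ℝ, E) 𝓘(ℝ, F) ∞ G M]
  {g : Bundle.ContMDiffRiemannianMetric 𝓘(ℝ, F) ∞ F (fun x : M => TangentSpace 𝓘(ℝ, F) x)}

/-- The acceleration of a curve in the coordinates of the preferred chart at its position. -/
lemma coordMetric_covDerivAlong_velocity {γ : ℝ → M} {t₀ : ℝ} {x' : ℝ → F} {a : F}
    (hx : ∀ᶠ t in 𝓝 t₀, HasDerivAt (fun s => extChartAt 𝓘(ℝ, F) (γ t₀) (γ s)) (x' t) t)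
    (hv : ∀ᶠ t in 𝓝 t₀, (mfderiv 𝓘(ℝ, F) 𝓘(ℝ, F) (extChartAt 𝓘(ℝ, F) (γ t₀)) (γ t)
      (velocity γ t) : F) = x' t)
    (ha : HasDerivAt x' a t₀) (w : TangentSpace 𝓘(ℝ, F) (γ t₀)) :
    g.inner (γ t₀) w (covDerivAlong g γ (velocity γ) t₀)
      = coordMetric g (γ t₀) (extChartAt 𝓘(ℝ, F) (γ t₀) (γ t₀)) w a
        + fderiv ℝ (coordMetric g (γ t₀)) (extChartAt 𝓘(ℝ, F) (γ t₀) (γ t₀)) (x' t₀) w (x' t₀)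
        - 1 / 2 * fderiv ℝ (coordMetric g (γ t₀)) (extChartAt 𝓘(ℝ, F) (γ t₀) (γ t₀)) w
          (x' t₀) (x' t₀) := by
  have hcov : (covDerivAlong g γ (velocity γ) t₀ : F)
      = ∑ k, ((Module.finBasis ℝ F).coord k a
        + ∑ i, ∑ j, christoffel g (γ t₀) k i j (extChartAt 𝓘(ℝ, F) (γ t₀) (γ t₀))
          * (Module.finBasis ℝ F).coord i (x' t₀) * (Module.finBasis ℝ F).coord j (x' t₀)) •
        Module.finBasis ℝ F k := by
    have hcoord : ∀ {f : ℝ → F} {f' : F} (k : Fin (Module.finrank ℝ F)), HasDerivAt f f' t₀ →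
        deriv (fun s => (Module.finBasis ℝ F).coord k (f s)) t₀
          = (Module.finBasis ℝ F).coord k f' := by
      intro f f' k hf
      exact ((LinearMap.toContinuousLinearMap
        ((Module.finBasis ℝ F).coord k)).hasFDerivAt.comp_hasDerivAt t₀ hf).deriv
    have h1 : ∀ k, deriv (fun s => (Module.finBasis ℝ F).coord k
        (mfderiv 𝓘(ℝ, F) 𝓘(ℝ, F) (extChartAt 𝓘(ℝ, F) (γ t₀)) (γ s) (velocity γ s))) t₀
          = (Module.finBasis ℝ F).coord k a :=
      fun k => hcoord k (ha.congr_of_eventuallyEq hv)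
    have h2 : ∀ k, deriv (fun s => (Module.finBasis ℝ F).coord k
        (extChartAt 𝓘(ℝ, F) (γ t₀) (γ s))) t₀ = (Module.finBasis ℝ F).coord k (x' t₀) :=
      fun k => hcoord k hx.self_of_nhds
    unfold covDerivAlong
    refine Finset.sum_congr rfl fun k _ => ?_
    rw [h1 k]
    refine congrArg₂ (fun (r : ℝ) (u : F) => r • u) ?_ (coordVector_self (γ t₀) k)
    refine congrArg _ (Finset.sum_congr rfl fun i _ => Finset.sum_congr rfl fun j _ => ?_)
    rw [h2 i]
    exact congrArg (fun u : F => _ * (Module.finBasis ℝ F).coord j u) hv.self_of_nhds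
  rw [← coordMetric_sum_christoffel g (γ t₀) w (x' t₀) a, ← hcov]
  exact (coordMetric_self g (γ t₀) w _).symm

/-- The component along `Ŵ` of the acceleration of the curve `α · o` in a homogeneous space with
an invariant Riemannian metric, in terms of the left logarithmic derivative `U` of `α`. -/
theorem functionG_eq_of_hasLeftLogDerivAt (hg : IsInvariantMetric G g) (o : M) {α : ℝ → G}
    (hα : ContMDiff 𝓘(ℝ, ℝ) 𝓘(ℝ, E) ∞ α) {U : ℝ → GroupLieAlgebra 𝓘(ℝ, E) G}
    (hU : ∀ t, HasLeftLogDerivAt α (U t) t) {t₀ : ℝ} {U' : GroupLieAlgebra 𝓘(ℝ, E) G}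
    (hU' : HasDerivAt (F := E) U U' t₀)
    (W : GroupLieAlgebra 𝓘(ℝ, E) G) :
    functionG g o α W t₀
      = g.inner o (projO (G := G) o (U t₀))
          (projO (G := G) o ⁅W, U t₀⁆)
        + g.inner o (projO o W) (projO (G := G) o (U' : GroupLieAlgebra 𝓘(ℝ, E) G)) := by
  -- Over `ℝ` this smoothness is 3; it provides the Lie ring laws of the bracket, such as `neg_lie`.
  have : LieGroup 𝓘(ℝ, E) (minSmoothness ℝ 3) G := by
    rw [minSmoothness_of_isRCLikeNormedField]; infer_instance
  let γ : ℝ → M := fun t => α t • o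
  let φ := extChartAt 𝓘(ℝ, F) (γ t₀)
  let e : ℝ → G := fun s => lieExp (s • W)
  have he : ContMDiff 𝓘(ℝ, ℝ) 𝓘(ℝ, E) ∞ e := contMDiff_lieExp_smul W
  have he0 : e 0 = 1 := lieExp_zero_smul W
  have heW : HasLeftLogDerivAt e W 0 := hasLeftLogDerivAt_lieExp W 0
  -- Multiplying by `exp(sW)` on the right makes `Ŵ` the variation field at `s = 0`, and each
  -- `t`-curve remains the orbit of a curve with known logarithmic derivative.
  let c : ℝ × ℝ → M := fun q => (α q.2 * e q.1) • o
  have hc : ContMDiff 𝓘(ℝ, ℝ × ℝ) 𝓘(ℝ, F) ∞ c := by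
    have f1 : ContMDiff 𝓘(ℝ, ℝ × ℝ) 𝓘(ℝ, ℝ) ∞ (fun q : ℝ × ℝ => q.1) := contDiff_fst.contMDiff
    have f2 : ContMDiff 𝓘(ℝ, ℝ × ℝ) 𝓘(ℝ, ℝ) ∞ (fun q : ℝ × ℝ => q.2) := contDiff_snd.contMDiff
    exact (contMDiff_orbit E G F o).comp ((hα.comp f2).mul (he.comp f1))
  have hc0 : ∀ t, c (0, t) = γ t := fun t => by simp [c, γ, he0]
  let f : ℝ × ℝ → F := fun q => φ (c q)
  have hf : ContDiffAt ℝ 2 f (0, t₀) := by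
    have hφ : ContMDiffAt 𝓘(ℝ, F) 𝓘(ℝ, F) ∞ φ (c (0, t₀)) := by
      rw [hc0]; exact contMDiffAt_extChartAt
    exact ((hφ.comp (0, t₀) hc.contMDiffAt).contDiffAt).of_le ENat.LEInfty.out
  have hf0 : f (0, t₀) = φ (γ t₀) := congrArg φ (hc0 t₀)
  have hgood : ∀ᶠ q in 𝓝 ((0 : ℝ), t₀), DifferentiableAt ℝ f q ∧ c q ∈ φ.source := by
    refine ((hf.eventually (by simp)).mono fun q hq => hq.differentiableAt (by simp)).and ?_
    exact hc.continuous.continuousAt.eventually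
      (by rw [hc0]; exact extChartAt_source_mem_nhds (γ t₀))
  have hs : ∀ᶠ s in 𝓝 (0 : ℝ), DifferentiableAt ℝ f (s, t₀) ∧ c (s, t₀) ∈ φ.source := by
    have hcont : Continuous fun s : ℝ => (s, t₀) := by fun_prop
    exact hcont.continuousAt.eventually hgood
  have ht : ∀ᶠ t in 𝓝 t₀, DifferentiableAt ℝ f (0, t) ∧ c (0, t) ∈ φ.source := by
    have hcont : Continuous fun t : ℝ => ((0 : ℝ), t) := by fun_prop
    exact hcont.continuousAt.eventually hgood
  have hpt : ∀ s t, DifferentiableAt ℝ f (s, t) →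
      HasDerivAt (fun t => f (s, t)) (fderiv ℝ f (s, t) (0, 1)) t := fun s t hd =>
    HasFDerivAt.comp_hasDerivAt (l := f) (f := fun t => (s, t)) t hd.hasFDerivAt
      ((hasDerivAt_const _ _).prodMk (hasDerivAt_id _))
  have hps : ∀ s t, DifferentiableAt ℝ f (s, t) →
      HasDerivAt (fun s => f (s, t)) (fderiv ℝ f (s, t) (1, 0)) s := fun s t hd =>
    HasFDerivAt.comp_hasDerivAt (l := f) (f := fun s => (s, t)) s hd.hasFDerivAt
      ((hasDerivAt_id _).prodMk (hasDerivAt_const _ _))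
  -- the partial derivatives of the variation
  have hft : ∀ s t, DifferentiableAt ℝ f (s, t) → c (s, t) ∈ φ.source →
      fderiv ℝ f (s, t) (0, 1) = mfderiv 𝓘(ℝ, F) 𝓘(ℝ, F) φ ((α t * e s) • o)
        (hatField o (Ad (e s)⁻¹ (U t)) (α t * e s)) :=
    fun s t hd hsrc => (hpt s t hd).unique
      (((hU t).mul_const (e s)).hasDerivAt_extChartAt_smul o (γ t₀) hsrc)
  have hγt : ∀ t, DifferentiableAt ℝ f (0, t) → c (0, t) ∈ φ.source →
      fderiv ℝ f (0, t) (0, 1) = mfderiv 𝓘(ℝ, F) 𝓘(ℝ, F) φ (γ t)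
        (hatField o (U t) (α t)) := by
    intro t hd hsrc
    have h1 := hpt 0 t hd
    have h2 := (hU t).hasDerivAt_extChartAt_smul o (γ t₀) (by rw [hc0] at hsrc; exact hsrc)
    have h3 : (fun t => f (0, t)) = fun s => extChartAt 𝓘(ℝ, F) (γ t₀) (α s • o) :=
      funext fun t => congrArg φ (hc0 t)
    rw [h3] at h1
    exact h1.unique h2
  have hγs : ∀ t, DifferentiableAt ℝ f (0, t) → c (0, t) ∈ φ.source →
      fderiv ℝ f (0, t) (1, 0) = mfderiv 𝓘(ℝ, F) 𝓘(ℝ, F) φ (γ t) (hatField o W (α t)) := by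
    intro t hd hsrc
    have h1 := hps 0 t hd
    have h2 := (heW.const_mul (α t)).hasDerivAt_extChartAt_smul o (γ t₀) hsrc
    have aux : ∀ b : G, b = α t →
        (mfderiv 𝓘(ℝ, F) 𝓘(ℝ, F) φ (b • o) (hatField o W b) : F)
          = mfderiv 𝓘(ℝ, F) 𝓘(ℝ, F) φ (γ t) (hatField o W (α t)) := by
      rintro b rfl
      rfl
    exact (h1.unique h2).trans (aux _ (by rw [he0, mul_one]))
  -- the energy density and the pairing with the variation field, by invariance of the metric
  let Q : E →L[ℝ] E →L[ℝ] ℝ :=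
    (ContinuousLinearMap.compL ℝ E F ℝ).flip (projO (F := F) (G := G) o : E →L[ℝ] F) ∘L
      ((g.inner o : F →L[ℝ] F →L[ℝ] ℝ) ∘L (projO (F := F) (G := G) o : E →L[ℝ] F))
  have hQ : ∀ A B : GroupLieAlgebra 𝓘(ℝ, E) G, Q A B = g.inner o (projO o A) (projO o B) := fun A B => rfl
  have hN : ∀ᶠ s in 𝓝 (0 : ℝ), coordMetric g (γ t₀) (f (s, t₀)) (fderiv ℝ f (s, t₀) (0, 1))
      (fderiv ℝ f (s, t₀) (0, 1))
        = Q (Ad (e s)⁻¹ (U t₀))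
          (Ad (e s)⁻¹ (U t₀)) := by
    filter_upwards [hs] with s hs'
    rw [hft s t₀ hs'.1 hs'.2]
    exact (coordMetric_mfderiv_extChartAt g (γ t₀) hs'.2 _ _).trans
      (inner_hatField hg o _ _ (α t₀ * e s))
  have hB : ∀ᶠ t in 𝓝 t₀, coordMetric g (γ t₀) (f (0, t)) (fderiv ℝ f (0, t) (1, 0))
      (fderiv ℝ f (0, t) (0, 1)) = Q (W : E) (U t) := by
    filter_upwards [ht] with t ht'
    have hsrc := ht'.2
    rw [hc0] at hsrc
    rw [hγt t ht'.1 ht'.2, hγs t ht'.1 ht'.2,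
      show f (0, t) = φ (γ t) from congrArg φ (hc0 t)]
    exact (coordMetric_mfderiv_extChartAt g (γ t₀) hsrc _ _).trans (inner_hatField hg o _ _ (α t))
  obtain ⟨n, b, hn, hb, hacc, hnb⟩ := exists_hasDerivAt_energy_variation hf
    (h := coordMetric g (γ t₀))
    (differentiableAt_coordMetric g (γ t₀) (by rw [hf0]; exact mem_extChartAt_target (γ t₀)))
    (coordMetric_symm g (γ t₀) _)
  have hb' : b = Q (W : E) U' := by
    refine hb.unique (HasDerivAt.congr_of_eventuallyEq ?_ hB)
    exact (Q W).hasFDerivAt.comp_hasDerivAt t₀ hU'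
  let L : GroupLieAlgebra 𝓘(ℝ, E) G := ⁅W, U t₀⁆
  have hAd : HasDerivAt (F := E) (fun s => Ad (e s)⁻¹ (U t₀)) (-L) 0 := by
    have hinv : HasLeftLogDerivAt (fun s => (e s)⁻¹) (-W) 0 := by
      have h := heW.inv
      rwa [he0, Ad_one_apply] at h
    have h := hasDerivAt_Ad_of_eq_one he.inv (by simp [he0]) hinv (U t₀)
    have hL : ⁅-W, U t₀⁆ = -L := neg_lie W (U t₀)
    rwa [hL] at h
  have hA0 : Ad (e 0)⁻¹ (U t₀) = U t₀ := by rw [he0, inv_one, Ad_one_apply]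
  -- `Ad(exp(-sW)) U` has derivative `-[W, U]` at `0`; the factor 2 comes from the symmetry of `Q`.
  have hn' : n = -2 * Q (U t₀) L := by
    have h0 : HasDerivAt (fun s => Q (Ad (e s)⁻¹ (U t₀))) (Q (-L)) 0 :=
      Q.hasFDerivAt.comp_hasDerivAt (0 : ℝ) hAd
    have h1 := (h0.clm_apply hAd).congr_of_eventuallyEq hN
    have h2 := hn.unique h1
    rw [hA0] at h2
    have h3 : Q (-L) (U t₀) = -Q L (U t₀) := congrArg (fun B : E →L[ℝ] ℝ => B (U t₀)) (map_neg Q L)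
    have h4 : Q (U t₀) (-L) = -Q (U t₀) L := map_neg (Q (U t₀)) L
    have h5 : Q L (U t₀) = Q (U t₀) L := g.symm o _ _
    rw [h3, h4, h5] at h2
    rw [h2]
    ring
  have hvel : ∀ t, velocity (F := F) γ t = hatField (F := F) o (U t) (α t) :=
    fun t => HasMFDerivAt.mfderiv_one ((hU t).smul o)
  have hmain := coordMetric_covDerivAlong_velocity (g := g) (γ := γ) (t₀ := t₀)
    (x' := fun t => fderiv ℝ f (0, t) (0, 1))
    (ht.mono fun t ht' => by
      have h := hpt 0 t ht'.1
      have h3 : (fun t => f (0, t)) = fun s => extChartAt 𝓘(ℝ, F) (γ t₀) (γ s) :=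
        funext fun t => congrArg φ (hc0 t)
      rwa [h3] at h)
    (ht.mono fun t ht' => by rw [hvel, hγt t ht'.1 ht'.2]) hacc (hatField o W (α t₀))
  have h₀ := ht.self_of_nhds
  have : IsManifold 𝓘(ℝ, F) 1 M := .of_le (n := ∞) (by exact_mod_cast le_top)
  have hw : fderiv ℝ f (0, t₀) (1, 0) = (hatField o W (α t₀) : F) := by
    rw [hγs t₀ h₀.1 h₀.2]
    exact congrArg (fun A : F →L[ℝ] F => A (hatField o W (α t₀))) mfderiv_extChartAt_self
  rw [hf0, hw] at hnb
  -- The coordinate expressions of the acceleration component and of the first variation coincide,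
  -- so the function equals `b - n / 2`.
  refine (hmain.trans hnb.symm).trans ?_
  rw [hn', hb', ← hQ, ← hQ]
  ring

end Acceleration

/-! ### Products of three exponentials -/

section ThreeExponentials

variable {E : Type*} [NormedAddCommGroup E] [NormedSpace ℝ E] [CompleteSpace E]
  {G : Type*} [TopologicalSpace G] [T2Space G] [ChartedSpace E G] [Group G]
  [LieGroup 𝓘(ℝ, E) ∞ G]

lemma Ad_inv_lieExp_self (X : GroupLieAlgebra 𝓘(ℝ, E) G) (t : ℝ) :
    Ad (lieExp (t • X))⁻¹ X = X := by
  rw [← lieExp_neg_smul, ← neg_smul, Ad_lieExp_self]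

/-- The product rule gives `Ad(exp(-tZ))(Ad(exp(-tY))X + Y) + Z`. As `Ad(exp(-tY))` fixes `Y`, the
same operator `T` can be applied to `X` and to `Y`. -/
lemma hasLeftLogDerivAt_lieExp_mul_lieExp_mul_lieExp
    (X Y Z : GroupLieAlgebra 𝓘(ℝ, E) G) (t : ℝ) :
    HasLeftLogDerivAt (fun s => lieExp (s • X) * lieExp (s • Y) * lieExp (s • Z))
      (Ad (lieExp (-(t • Z)) * lieExp (-(t • Y))) X
        + Ad (lieExp (-(t • Z)) * lieExp (-(t • Y))) Y + Z) t := by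
  have h := ((hasLeftLogDerivAt_lieExp X t).mul (hasLeftLogDerivAt_lieExp Y t)).mul
    (hasLeftLogDerivAt_lieExp Z t)
  rwa [map_add, ← Ad_mul_apply, ← lieExp_neg_smul, ← lieExp_neg_smul, show
    Ad (lieExp (-(t • Z))) Y = Ad (lieExp (-(t • Z)) * lieExp (-(t • Y))) Y by
      rw [Ad_mul_apply, lieExp_neg_smul Y, Ad_inv_lieExp_self]] at h

/-- The curve `exp(-tZ) exp(-tY)` has logarithmic derivative `V = -(Ad(exp(tY))Z + Y)`. Hence `(TB)'
= T[V, B] = [TV, TB]`, and `TV = -(Z + TY)` because `T Ad(exp(tY)) = Ad(exp(-tZ))` fixes `Z`. -/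
lemma hasDerivAt_Ad_lieExp_neg_mul_lieExp_neg
    (Y Z B : GroupLieAlgebra 𝓘(ℝ, E) G) (t : ℝ) :
    HasDerivAt (F := E) (fun s => Ad (lieExp (-(s • Z)) * lieExp (-(s • Y))) B)
      (⁅Ad (lieExp (-(t • Z)) * lieExp (-(t • Y))) B,
        Ad (lieExp (-(t • Z)) * lieExp (-(t • Y))) Y + Z⁆ : GroupLieAlgebra 𝓘(ℝ, E) G) t := by
  have : LieGroup 𝓘(ℝ, E) (minSmoothness ℝ 3) G := by
    rw [minSmoothness_of_isRCLikeNormedField]; infer_instance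
  simp only [lieExp_neg_smul]
  have hlog := (hasLeftLogDerivAt_lieExp Z t).inv.mul (hasLeftLogDerivAt_lieExp Y t).inv
  rw [Ad_lieExp_self, Ad_lieExp_self, inv_inv] at hlog
  have h := HasLeftLogDerivAt.hasDerivAt_Ad
    (β := fun s => (lieExp (s • Z))⁻¹ * (lieExp (s • Y))⁻¹)
    ((contMDiff_lieExp_smul Z).inv.mul (contMDiff_lieExp_smul Y).inv) hlog B
  rw [Ad_bracket] at h
  have key : Ad ((lieExp (t • Z))⁻¹ * (lieExp (t • Y))⁻¹) (Ad (lieExp (t • Y)) (-Z) + -Y)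
      = -(Ad ((lieExp (t • Z))⁻¹ * (lieExp (t • Y))⁻¹) Y + Z) := by
    rw [map_add, ← Ad_mul_apply, inv_mul_cancel_right, map_neg, map_neg, Ad_inv_lieExp_self]
    abel
  rw [key] at h
  have hskew : ∀ A C : GroupLieAlgebra 𝓘(ℝ, E) G, ⁅-A, C⁆ = ⁅C, A⁆ := fun A C => by
    rw [neg_lie, lie_skew]
  rwa [hskew] at h

end ThreeExponentials

theorem proposition2p3
    {E : Type*} [NormedAddCommGroup E] [NormedSpace ℝ E] [FiniteDimensional ℝ E]
    {G : Type*} [TopologicalSpace G] [T2Space G] [ChartedSpace E G] [Group G]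
    [LieGroup 𝓘(ℝ, E) ∞ G]
    {F : Type*} [NormedAddCommGroup F] [NormedSpace ℝ F] [FiniteDimensional ℝ F]
    {M : Type*} [TopologicalSpace M] [T2Space M] [ChartedSpace F M] [IsManifold 𝓘(ℝ, F) ∞ M]
    [MulAction G M] [ContMDiffSMul 𝓘(ℝ, E) 𝓘(ℝ, F) ∞ G M] [MulAction.IsPretransitive G M]
    (o : M) (hπ : Manifold.IsSubmersion 𝓘(ℝ, E) 𝓘(ℝ, F) ∞ (fun a : G => a • o))
    (g : Bundle.ContMDiffRiemannianMetric 𝓘(ℝ, F) ∞ F (fun x : M => TangentSpace 𝓘(ℝ, F) x))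
    (hg : IsInvariantMetric G g)
    (𝔨 𝔪 : Submodule ℝ (GroupLieAlgebra 𝓘(ℝ, E) G)) (h𝔪 : IsReductiveDecomposition o 𝔨 𝔪)
    (X Y Z : GroupLieAlgebra 𝓘(ℝ, E) G) (hX : X ∈ 𝔪) (hY : Y ∈ 𝔪) (hZ : Z ∈ 𝔪) :
    let α : ℝ → G := fun t => lieExp (t • X) * lieExp (t • Y) * lieExp (t • Z)
    let T : ℝ → GroupLieAlgebra 𝓘(ℝ, E) G →L[ℝ] GroupLieAlgebra 𝓘(ℝ, E) G :=
      fun t => Ad (lieExp (-(t • Z)) * lieExp (-(t • Y)))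
    let P : GroupLieAlgebra 𝓘(ℝ, E) G →L[ℝ] TangentSpace 𝓘(ℝ, F) o := projO o
    ContMDiff 𝓘(ℝ, ℝ) 𝓘(ℝ, F) ∞ (fun t => α t • o) ∧
    ∀ W ∈ 𝔪, ∀ t : ℝ,
      functionG g o α W t =
        g.inner o (P (T t X) + P (T t Y) + P Z) (P ⁅W, T t X + T t Y + Z⁆)
          + g.inner o (P W) (P ⁅T t X, T t Y + Z⁆ + P ⁅T t Y, Z⁆) := by
  have : CompleteSpace E := FiniteDimensional.complete ℝ E
  have : LieGroup 𝓘(ℝ, E) (minSmoothness ℝ 3) G := by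
    rw [minSmoothness_of_isRCLikeNormedField]; infer_instance
  intro α T P
  have hα : ContMDiff 𝓘(ℝ, ℝ) 𝓘(ℝ, E) ∞ α :=
    ((contMDiff_lieExp_smul X).mul (contMDiff_lieExp_smul Y)).mul (contMDiff_lieExp_smul Z)
  refine ⟨(contMDiff_orbit E G F o).comp hα, fun W _ t => ?_⟩
  have hT := hasDerivAt_Ad_lieExp_neg_mul_lieExp_neg Y Z
  -- The derivative of the logarithmic derivative of `α`; its contribution `[TY, TY]` vanishes
  -- below.
  have hU' : HasDerivAt (F := E) (fun s => T s X + T s Y + Z)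
      (⁅T t X, T t Y + Z⁆ + ⁅T t Y, T t Y + Z⁆ : GroupLieAlgebra 𝓘(ℝ, E) G) t :=
    HasDerivAt.add_const (F := E) Z (HasDerivAt.add (F := E) (hT X t) (hT Y t))
  have hYZ : ⁅T t Y, T t Y + Z⁆ = ⁅T t Y, Z⁆ := by rw [lie_add, lie_self, zero_add]
  rw [functionG_eq_of_hasLeftLogDerivAt hg o hα
    (hasLeftLogDerivAt_lieExp_mul_lieExp_mul_lieExp X Y Z) hU' W, hYZ]
  have hPU : P (T t X + T t Y + Z) = P (T t X) + P (T t Y) + P Z := by rw [map_add, map_add]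
  have hPU' : P (⁅T t X, T t Y + Z⁆ + ⁅T t Y, Z⁆) = P ⁅T t X, T t Y + Z⁆ + P ⁅T t Y, Z⁆ :=
    map_add P _ _
  rw [← hPU, ← hPU']
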